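/- Let $\mathcal G=(\mathcal V,\mathcal E)$ be a finite undirected unweighted graph with $N$ nodes and $M$ edges and no self-loops. For a graph $\mathcal G'$ on $\mathcal V$ let $S(\mathcal G')$ be its shift operator, which is either always the adjacency matrix (put $\alpha=1$) or always the Laplacian matrix (put $\alpha=2$). For $p\in[0,1]$, a realization of $\mathrm{RES}(\mathcal G,p)$ is the random graph on $\mathcal V$ that keeps each edge of $\mathcal G$ independently with probability $p$. A filter of order $K$ with real coefficients $h=(h_0,\dots,h_K)$ maps a signal $x\in\mathbb R^N$ to $H(S_{K:0})x=\sum_{k=0}^K h_k S_k\cdots S_1x$, where $S_1,\dots,S_K$ are the shift operators of independent realizations of $\mathrm{RES}(\mathcal G,p)$. Its frequency response is $h(\lambda)=\sum_{k=0}^K h_k\lambda^k$, and its generalized frequency response is $h(\lambda_1,\dots,\lambda_K)=\sum_{k=0}^K h_k\lambda_1\cdots\lambda_k$. The stochastic graph neural network (SGNN) with $L\ge2$ layers, $F$ features and pointwise nonlinearity $\sigma:\mathbb R\to\mathbb R$ is $$x_1^f=\sigma\big[H_1^f x\big],\qquad x_\ell^f=\sigma\Big[\sum_{g=1}^F H_\ell^{fg}x_{\ell-1}^g\Big]\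 (2\le\ell\le L-1),\qquad \Phi(x)=\sigma\Big[\sum_{g=1}^F H_L^{g}x_{L-1}^g\Big],$$ where $1\le f\le F$, every filter has order $K$ and its own coefficients, and all the graph realizations used, over all filters and all $K$ shifts of each filter, are independent. Let $\Lambda\subseteq\mathbb R$ be a set that contains the eigenvalues of $S(\mathcal G')$ for every subgraph $\mathcal G'=(\mathcal V,\mathcal E')$, $\mathcal E'\subseteq\mathcal E$. Assume that every filter of the SGNN satisfies $|h(\lambda)|\le C_U$ for all $\lambda\in\Lambda$ and $|h(\boldsymbol\lambda)-h(\boldsymbol\lambda')|\le C_g\|\boldsymbol\lambda-\boldsymbol\lambda'\|_2$ for all $\boldsymbol\lambda,\boldsymbol\lambda'\in\Lambda^K$. Assume that $\sigma(0)=0$, that $|\sigma(a)-\sigma(b)|\le C_\sigma|a-b|$ for all $a,b\in\mathbb R$, and that $\mathrm{var}[\sigma(X)]\le\mathrm{var}[X]$ for every square-integrable real random variable $X$. Then, for every input signal $x$ and every $p\in[0,1]$, $$\sum_{i=1}^N\mathrm{var}\big[[\Phi(x)]_i\big]\le p(1-p)\,C\,\|x\|_2^2+R\,\|x\|_2^2\,p^2(1-p)^2,\qquad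 C=2\alpha M\sum_{\ell=1}^L F^{2L-3}C_\sigma^{2\ell-2}C_U^{2L-2}KC_g^2,$$ where the constant $R$ depends only on $\mathcal G$, the choice of shift operator, $L$, $F$, $K$, $C_U$, $C_g$ and $C_\sigma$ (and not on $p$, $x$, $\Lambda$, the filter coefficients or $\sigma$). -/

import Mathlib

open MeasureTheory ProbabilityTheory

namespace SGNN

/-- The two choices of graph shift operator. -/
inductive ShiftKind where
  | adjacency
  | laplacian

/-- The scalar `α` attached to the shift operator. -/
def ShiftKind.alpha : ShiftKind → ℝ
  | .adjacency => 1
  | .laplacian => 2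

open Classical in
/-- The shift operator of an unweighted graph: its adjacency matrix `A`, or its Laplacian
`L = diag (A 1) - A`. -/
noncomputable def shiftOp {V : Type*} [Fintype V] (s : ShiftKind) (H : SimpleGraph V) :
    Matrix V V ℝ :=
  match s with
  | .adjacency => H.adjMatrix ℝ
  | .laplacian => H.lapMatrix ℝ

/-- `𝒢` is a family of independent realizations of the random edge sampling graph `RES(G, p)`:
every realization keeps all the vertices and a subset of the edges of `G`, each edge of `G` is
kept in each realization with probability `p`, and all these edge inclusions, over all edges and
all realizations, are mutually independent. -/
structure IsRESFamily {V Ω ι : Type*} [MeasurableSpace Ω] (G : SimpleGraph V) (p : ℝ)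
    (μ : Measure Ω) (𝒢 : ι → Ω → SimpleGraph V) : Prop where
  le : ∀ i ω, 𝒢 i ω ≤ G
  measurableSet_edge : ∀ i, ∀ e ∈ G.edgeSet, MeasurableSet {ω | e ∈ (𝒢 i ω).edgeSet}
  prob_edge : ∀ i, ∀ e ∈ G.edgeSet, μ {ω | e ∈ (𝒢 i ω).edgeSet} = ENNReal.ofReal p
  indep : iIndepSet (fun q : ι × G.edgeSet => {ω | (q.2 : Sym2 V) ∈ (𝒢 q.1 ω).edgeSet}) μ

/-- The diffusion sequence `x⁽⁰⁾ = x`, `x⁽ᵏ⁺¹⁾ = S_{k+1} x⁽ᵏ⁾`, for `0 ≤ k ≤ K`.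
The shift operators `S_1, …, S_K` are indexed from `0`, so that `S_{k+1}` is `S k`. -/
def diffusion {V : Type*} [Fintype V] {K : ℕ} (S : Fin K → Matrix V V ℝ) (x : V → ℝ) :
    Fin (K + 1) → V → ℝ :=
  Fin.induction (motive := fun _ => V → ℝ) x (fun k y => (S k).mulVec y)

/-- The graph filter of order `K` with coefficients `h_0, …, h_K` over the sequence of shift
operators `S_1, …, S_K`: the signal `∑ k, h_k S_k ⋯ S_1 x`. -/
def graphFilter {V : Type*} [Fintype V] {K : ℕ} (h : Fin (K + 1) → ℝ)
    (S : Fin K → Matrix V V ℝ) (x : V → ℝ) : V → ℝ :=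
  ∑ k : Fin (K + 1), h k • diffusion S x k

/-- The frequency response `h(λ) = ∑ k, h_k λ^k`. -/
def freqResponse {K : ℕ} (h : Fin (K + 1) → ℝ) (lam : ℝ) : ℝ :=
  ∑ k : Fin (K + 1), h k * lam ^ (k : ℕ)

/-- The generalized frequency response `h(λ_1, …, λ_K) = ∑ k, h_k λ_1 ⋯ λ_k`.
The variables are indexed from `0`. -/
def genFreqResponse {K : ℕ} (h : Fin (K + 1) → ℝ) (lam : EuclideanSpace ℝ (Fin K)) : ℝ :=
  ∑ k : Fin (K + 1), h k * ∏ j ∈ Finset.univ.filter (fun j : Fin K => (j : ℕ) < (k : ℕ)), lam j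

/-- The filters of an SGNN with `L ≥ 2` layers and `F` features: `F` filters in the first layer,
`F ^ 2` filters in each of the layers `2, …, L - 1` (`hidden l f g` maps input feature `g` to
output feature `f` in layer `l + 2`), and `F` filters in layer `L`. -/
inductive FilterIdx (L F : ℕ) where
  | input (f : Fin F)
  | hidden (l : Fin (L - 2)) (f g : Fin F)
  | output (g : Fin F)

/-- The features `x_ℓ^f` of the layers `ℓ = 1, …, L - 1`; the layer `ℓ` has index `ℓ - 1`. -/
def features {V : Type*} [Fintype V] {L F K : ℕ} (σ : ℝ → ℝ)
    (h : FilterIdx L F → Fin (K + 1) → ℝ) (S : FilterIdx L F → Fin K → Matrix V V ℝ)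
    (x : V → ℝ) : Fin (L - 2 + 1) → Fin F → V → ℝ :=
  Fin.induction (motive := fun _ => Fin F → V → ℝ)
    (fun f v => σ (graphFilter (h (.input f)) (S (.input f)) x v))
    (fun l y f v => σ (∑ g, graphFilter (h (.hidden l f g)) (S (.hidden l f g)) (y g) v))

/-- The output of the SGNN with nonlinearity `σ`, filter tensor `h` and shift operators `S` on
the input signal `x` (for `L ≥ 2`): a single feature, computed from the features of layer
`L - 1`. -/
def sgnn {V : Type*} [Fintype V] {L F K : ℕ} (σ : ℝ → ℝ)
    (h : FilterIdx L F → Fin (K + 1) → ℝ) (S : FilterIdx L F → Fin K → Matrix V V ℝ)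
    (x : V → ℝ) : V → ℝ :=
  fun v => σ (∑ g, graphFilter (h (.output g)) (S (.output g))
    (features σ h S x (Fin.last (L - 2)) g) v)

/-- The SGNN output on a realization `𝒢` of its random graphs, one for each filter and each of
the `K` shifts of that filter. -/
noncomputable def randomOutput {V : Type*} [Fintype V] {L F K : ℕ} (s : ShiftKind) (σ : ℝ → ℝ)
    (h : FilterIdx L F → Fin (K + 1) → ℝ) (𝒢 : FilterIdx L F × Fin K → SimpleGraph V)
    (x : V → ℝ) : V → ℝ :=
  sgnn σ h (fun i k => shiftOp s (𝒢 (i, k))) x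

/-- The nonlinearity does not increase the variance of any square-integrable real random
variable (`ν` is the law of the variable). -/
def VarianceNonincreasing (σ : ℝ → ℝ) : Prop :=
  ∀ ν : Measure ℝ, IsProbabilityMeasure ν → MemLp id 2 ν →
    variance σ ν ≤ variance id ν

end SGNN

/-! Encode all realizations by the random set `A` of active pairs (shift of a filter, edge), so that
the output is `Φ A` on a finite power set. For `p ≤ 1/2`, bound the variance by the second moment of
`Φ A - Φ ∅`. One active pair contributes at first order in `p`; two or more have probability `O(p²)`
and go into `R`. For `p ≥ 1/2`, the same argument applies to the complement of `A`, with the full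
graph as base point and `q = 1 - p`. Since `q = q(1-q) + q²` and `q² ≤ 4q²(1-q)²` for `q ≤ 1/2`,
both cases have the claimed form (`sum_variance_le_of_le_half`).

The first-order coefficient is a deterministic sum of squared one-edge effects around a network
whose shifts all equal one symmetric `S`. In an eigenbasis of `S` an unperturbed filter is diagonal
with entries at most `C_U`, and changing one shift by `E` multiplies the entries of `E` by partial
derivatives of the generalized response. These are at most `C_g`, so the change has Frobenius norm
at most `C_g ‖E‖`, where `‖E‖² = 2α` (`l2norm_graphFilter_update_sub_le`). Propagating through the
layers and summing over filters, shifts and edges gives at most `C`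
(`weight_mul_l2norm_sgnn_sub_le`, `FilterIdx.sum_inv_weight_sq_le`, `card_mul_propagation_sq_le`).

The last comparison uses that a map which does not increase variances is 1-Lipschitz, so `min 1
|C_σ|` is a Lipschitz constant. For `R` to be independent of the filters, their coefficients are
bounded through two points of `Λ`: 0 and an eigenvalue of a one-edge graph (`abs_coeff_le`). -/

namespace SGNN

/-! ### The Euclidean norm on `V → ℝ` and the Frobenius norm -/

/-- The Euclidean norm of a signal. -/
noncomputable def l2norm {V : Type*} [Fintype V] (y : V → ℝ) : ℝ :=
  ‖(WithLp.toLp 2 y : EuclideanSpace ℝ V)‖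

/-- The squared Frobenius norm of a matrix. -/
def frobSq {V : Type*} [Fintype V] (A : Matrix V V ℝ) : ℝ := ∑ i, ∑ j, A i j ^ 2

section Norms
variable {V : Type*} [Fintype V]

lemma l2norm_nonneg (y : V → ℝ) : 0 ≤ l2norm y := norm_nonneg _

lemma l2norm_sq (y : V → ℝ) : l2norm y ^ 2 = ∑ v, y v ^ 2 := by
  simp [l2norm, EuclideanSpace.real_norm_sq_eq]

@[simp] lemma l2norm_zero : l2norm (0 : V → ℝ) = 0 := by simp [l2norm]

lemma l2norm_add_le (y z : V → ℝ) : l2norm (y + z) ≤ l2norm y + l2norm z :=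
  norm_add_le (WithLp.toLp 2 y : EuclideanSpace ℝ V) (WithLp.toLp 2 z)

lemma l2norm_sub_le (y z : V → ℝ) : l2norm (y - z) ≤ l2norm y + l2norm z :=
  norm_sub_le (WithLp.toLp 2 y : EuclideanSpace ℝ V) (WithLp.toLp 2 z)

lemma l2norm_smul (a : ℝ) (y : V → ℝ) : l2norm (a • y) = |a| * l2norm y :=
  norm_smul a (WithLp.toLp 2 y : EuclideanSpace ℝ V)

lemma l2norm_sum_le {ι : Type*} (s : Finset ι) (y : ι → V → ℝ) :
    l2norm (∑ i ∈ s, y i) ≤ ∑ i ∈ s, l2norm (y i) := by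
  classical
  induction s using Finset.induction_on with
  | empty => simp
  | insert a s ha ih =>
    rw [Finset.sum_insert ha, Finset.sum_insert ha]
    exact (l2norm_add_le _ _).trans (by gcongr)

lemma l2norm_le_mul_of_abs_le {c : ℝ} (hc : 0 ≤ c) {y z : V → ℝ}
    (h : ∀ v, |y v| ≤ c * |z v|) : l2norm y ≤ c * l2norm z := by
  refine (sq_le_sq₀ (l2norm_nonneg y) (mul_nonneg hc (l2norm_nonneg z))).1 ?_
  rw [mul_pow, l2norm_sq, l2norm_sq, Finset.mul_sum]
  refine Finset.sum_le_sum fun v _ => ?_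
  rw [← sq_abs (y v), ← sq_abs (z v), ← mul_pow]
  exact pow_le_pow_left₀ (abs_nonneg _) (h v) 2

lemma l2norm_mulVec_sq_le (A : Matrix V V ℝ) (y : V → ℝ) :
    l2norm (A.mulVec y) ^ 2 ≤ frobSq A * l2norm y ^ 2 := by
  rw [l2norm_sq, l2norm_sq, frobSq, Finset.sum_mul]
  exact Finset.sum_le_sum fun i _ => Finset.sum_mul_sq_le_sq_mul_sq _ _ _

lemma frobSq_eq_trace (A : Matrix V V ℝ) : frobSq A = (A * A.transpose).trace := by
  simp [frobSq, Matrix.trace, Matrix.mul_apply, sq]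

/-- Cyclicity of the trace. This invariance is why the Frobenius norm is used: an entrywise bound in
an eigenbasis passes to it directly, while it would not control the operator norm with the same
constant. -/
lemma frobSq_conj [DecidableEq V] {W : Matrix V V ℝ} (hW : W.transpose * W = 1)
    (A : Matrix V V ℝ) : frobSq (W * A * W.transpose) = frobSq A := by
  rw [frobSq_eq_trace, frobSq_eq_trace]
  have : W * A * W.transpose * (W * A * W.transpose).transpose
      = W * (A * A.transpose * W.transpose) := by
    simp only [Matrix.transpose_mul, Matrix.transpose_transpose, Matrix.mul_assoc]
    rw [← Matrix.mul_assoc W.transpose W, hW, Matrix.one_mul]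
  rw [this, Matrix.trace_mul_comm, Matrix.mul_assoc, hW, Matrix.mul_one]

lemma l2norm_mulVec_of_orthogonal [DecidableEq V] {W : Matrix V V ℝ}
    (hW : W.transpose * W = 1) (y : V → ℝ) : l2norm (W.mulVec y) = l2norm y := by
  have key : l2norm (W.mulVec y) ^ 2 = l2norm y ^ 2 := by
    have e : ∀ z : V → ℝ, l2norm z ^ 2 = z ⬝ᵥ z := fun z => by
      rw [l2norm_sq]; simp [dotProduct, sq]
    rw [e, e, Matrix.dotProduct_mulVec, Matrix.vecMul_mulVec, hW, Matrix.vecMul_one]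
  exact (sq_eq_sq₀ (l2norm_nonneg _) (l2norm_nonneg _)).1 key

/-- Spectral theorem for a real symmetric matrix, with eigenvalues in the spectrum. -/
lemma exists_orthogonal_diagonalization [DecidableEq V] {A : Matrix V V ℝ}
    (hA : A.IsHermitian) :
    ∃ (W : Matrix V V ℝ) (d : V → ℝ), W.transpose * W = 1 ∧ W * W.transpose = 1 ∧
      A = W * Matrix.diagonal d * W.transpose ∧ ∀ i, d i ∈ spectrum ℝ A := by
  refine ⟨hA.eigenvectorUnitary, hA.eigenvalues, ?_, ?_, ?_, hA.eigenvalues_mem_spectrum_real⟩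
  · have := Unitary.coe_star_mul_self hA.eigenvectorUnitary
    rwa [Matrix.star_eq_conjTranspose, Matrix.conjTranspose_eq_transpose_of_trivial] at this
  · have := Unitary.coe_mul_star_self hA.eigenvectorUnitary
    rwa [Unitary.coe_star, Matrix.star_eq_conjTranspose, Matrix.conjTranspose_eq_transpose_of_trivial] at this
  · have := hA.spectral_theorem
    rw [Unitary.conjStarAlgAut_apply, Matrix.star_eq_conjTranspose,
      Matrix.conjTranspose_eq_transpose_of_trivial] at this
    exact this

lemma conj_diagonal_pow [DecidableEq V] {W : Matrix V V ℝ} (hW : W.transpose * W = 1)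
    (hW' : W * W.transpose = 1) (d : V → ℝ) (n : ℕ) :
    (W * Matrix.diagonal d * W.transpose) ^ n
      = W * Matrix.diagonal (fun i => d i ^ n) * W.transpose := by
  induction n with
  | zero => simp [hW']
  | succ n ih =>
    rw [pow_succ, ih]
    have : W * Matrix.diagonal (fun i => d i ^ n) * W.transpose
        * (W * Matrix.diagonal d * W.transpose)
        = W * (Matrix.diagonal (fun i => d i ^ n) * (W.transpose * W) * Matrix.diagonal d)
          * W.transpose := by
      simp only [Matrix.mul_assoc]
    rw [this, hW, Matrix.mul_one, Matrix.diagonal_mul_diagonal]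
    simp only [pow_succ]

end Norms

/-! ### Graph filters on deterministic shift operators -/

section Filter
variable {V : Type*} [Fintype V] {K : ℕ}

@[simp] lemma diffusion_zero (S : Fin K → Matrix V V ℝ) (x : V → ℝ) :
    diffusion S x 0 = x := rfl

@[simp] lemma diffusion_succ (S : Fin K → Matrix V V ℝ) (x : V → ℝ) (k : Fin K) :
    diffusion S x k.succ = (S k).mulVec (diffusion S x k.castSucc) := rfl

lemma diffusion_sub (S : Fin K → Matrix V V ℝ) (x y : V → ℝ) (k : Fin (K + 1)) :
    diffusion S (x - y) k = diffusion S x k - diffusion S y k := by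
  induction k using Fin.induction with
  | zero => simp
  | succ k ih => simp [ih, Matrix.mulVec_sub]

lemma graphFilter_sub (h : Fin (K + 1) → ℝ) (S : Fin K → Matrix V V ℝ) (x y : V → ℝ) :
    graphFilter h S (x - y) = graphFilter h S x - graphFilter h S y := by
  simp only [graphFilter, diffusion_sub, smul_sub, Finset.sum_sub_distrib]

/-- A crude bound, needed only for the second-order remainder. The assumption `1 ≤ b` replaces the
exponent `k` by `K` uniformly. -/
lemma l2norm_diffusion_le {S : Fin K → Matrix V V ℝ} {b : ℝ}
    (hb : ∀ k, frobSq (S k) ≤ b ^ 2) (hb1 : 1 ≤ b) (x : V → ℝ) (k : Fin (K + 1)) :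
    l2norm (diffusion S x k) ≤ b ^ K * l2norm x := by
  have hb0 : 0 ≤ b := zero_le_one.trans hb1
  have key : l2norm (diffusion S x k) ≤ b ^ (k : ℕ) * l2norm x := by
    induction k using Fin.induction with
    | zero => simp
    | succ k ih =>
      have h1 : l2norm ((S k).mulVec (diffusion S x k.castSucc))
          ≤ b * l2norm (diffusion S x k.castSucc) := by
        refine (sq_le_sq₀ (l2norm_nonneg _) (mul_nonneg hb0 (l2norm_nonneg _))).1 ?_
        rw [mul_pow]
        exact (l2norm_mulVec_sq_le _ _).trans
          (mul_le_mul_of_nonneg_right (hb k) (sq_nonneg _))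
      rw [diffusion_succ]
      calc _ ≤ b * l2norm (diffusion S x k.castSucc) := h1
        _ ≤ b * (b ^ (k : ℕ) * l2norm x) := by
            have := ih; simp only [Fin.val_castSucc] at this; gcongr
        _ = b ^ ((k.succ : Fin (K + 1)) : ℕ) * l2norm x := by
            rw [Fin.val_succ, pow_succ]; ring
  exact key.trans (mul_le_mul_of_nonneg_right
    (pow_le_pow_right₀ hb1 (Nat.lt_succ_iff.1 k.2)) (l2norm_nonneg x))

lemma l2norm_graphFilter_le {h : Fin (K + 1) → ℝ} {S : Fin K → Matrix V V ℝ} {a b : ℝ}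
    (ha : ∀ k, |h k| ≤ a) (hb : ∀ k, frobSq (S k) ≤ b ^ 2) (hb1 : 1 ≤ b) (x : V → ℝ) :
    l2norm (graphFilter h S x) ≤ (K + 1) * a * b ^ K * l2norm x := by
  have ha0 : 0 ≤ a := (abs_nonneg _).trans (ha 0)
  refine (l2norm_sum_le _ _).trans ?_
  calc ∑ k, l2norm (h k • diffusion S x k) ≤ ∑ _k : Fin (K + 1), a * (b ^ K * l2norm x) := by
        refine Finset.sum_le_sum fun k _ => ?_
        rw [l2norm_smul]
        exact mul_le_mul (ha k) (l2norm_diffusion_le hb hb1 x k) (l2norm_nonneg _) ha0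
    _ = _ := by simp; ring

variable [DecidableEq V]

lemma diffusion_const (S : Matrix V V ℝ) (x : V → ℝ) (k : Fin (K + 1)) :
    diffusion (fun _ : Fin K => S) x k = (S ^ (k : ℕ)).mulVec x := by
  induction k using Fin.induction with
  | zero => simp
  | succ k ih => simp [ih, pow_succ']

/-- The effect of perturbing a single shift operator on the diffusion sequence. -/
lemma diffusion_update (S E : Matrix V V ℝ) (x : V → ℝ) (k₀ : Fin K) (k : Fin (K + 1)) :
    diffusion (Function.update (fun _ : Fin K => S) k₀ (S + E)) x k
      = (S ^ (k : ℕ)).mulVec x + (if (k₀ : ℕ) < k then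
          S ^ ((k : ℕ) - k₀ - 1) * E * S ^ (k₀ : ℕ) else 0).mulVec x := by
  induction k using Fin.induction with
  | zero => simp
  | succ k ih =>
    rw [diffusion_succ, ih, Fin.val_succ, Fin.val_castSucc]
    rcases lt_trichotomy (k : ℕ) k₀ with hk | hk | hk
    · have hne : k ≠ k₀ := fun e => by simp [e] at hk
      rw [Function.update_of_ne hne, if_neg (by omega), if_neg (by omega)]
      simp [pow_succ']
    · obtain rfl : k = k₀ := Fin.ext hk
      rw [Function.update_self, if_neg (by omega), if_pos (by omega)]
      simp [pow_succ', Matrix.add_mul, Matrix.add_mulVec]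
    · have hne : k ≠ k₀ := fun e => by simp [e] at hk
      rw [Function.update_of_ne hne, if_pos hk, if_pos (by omega)]
      obtain ⟨n, hn⟩ := Nat.exists_eq_add_of_lt hk
      have h1 : (k : ℕ) + 1 - k₀ - 1 = n + 1 := by omega
      have h2 : (k : ℕ) - k₀ - 1 = n := by omega
      rw [h1, h2, Matrix.mulVec_add, Matrix.mulVec_mulVec, Matrix.mulVec_mulVec, pow_succ',
        pow_succ']
      simp only [Matrix.mul_assoc]

/-- The partial derivative of the generalized frequency response in its variable `k₀`, at a
point with the coordinates `b` before `k₀` and `a` after `k₀`. -/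
def partialResponse (h : Fin (K + 1) → ℝ) (k₀ : Fin K) (a b : ℝ) : ℝ :=
  ∑ k : Fin (K + 1), h k * if (k₀ : ℕ) < k then a ^ ((k : ℕ) - k₀ - 1) * b ^ (k₀ : ℕ) else 0

/-- The generalized response is affine in each variable, so its difference quotient between any two
distinct values of that variable is exactly the partial derivative. No limit is taken, and two
points of `Λ` suffice. -/
lemma abs_partialResponse_le {Λ : Set ℝ} {h : Fin (K + 1) → ℝ} {C_g : ℝ}
    (hg : ∀ lam₁ lam₂ : EuclideanSpace ℝ (Fin K), (∀ j, lam₁ j ∈ Λ) → (∀ j, lam₂ j ∈ Λ) →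
      |genFreqResponse h lam₁ - genFreqResponse h lam₂| ≤ C_g * ‖lam₁ - lam₂‖)
    {t₁ t₂ : ℝ} (ht₁ : t₁ ∈ Λ) (ht₂ : t₂ ∈ Λ) (hne : t₁ ≠ t₂) (k₀ : Fin K) {a b : ℝ}
    (ha : a ∈ Λ) (hb : b ∈ Λ) : |partialResponse h k₀ a b| ≤ C_g := by
  let z : ℝ → EuclideanSpace ℝ (Fin K) := fun t => WithLp.toLp 2
    (fun j => if j < k₀ then b else if j = k₀ then t else a)
  have hz : ∀ t ∈ Λ, ∀ j, z t j ∈ Λ := by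
    intro t ht j
    simp only [z]
    split_ifs <;> assumption
  have hnorm : ‖z t₁ - z t₂‖ = |t₁ - t₂| := by
    have : z t₁ - z t₂ = EuclideanSpace.single k₀ (t₁ - t₂) := by
      ext j
      simp only [z, PiLp.sub_apply, PiLp.single_apply]
      by_cases hj : j = k₀
      · simp [hj]
      · by_cases hj' : j < k₀ <;> simp [hj, hj']
    rw [this]; simp
  have hprod : ∀ (k : Fin (K + 1)) (t : ℝ),
      ∏ j ∈ Finset.univ.filter (fun j : Fin K => (j : ℕ) < (k : ℕ)), z t j
        = if (k₀ : ℕ) < k then t * (a ^ ((k : ℕ) - k₀ - 1) * b ^ (k₀ : ℕ)) else b ^ (k : ℕ) := by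
    intro k t
    have hk : (k : ℕ) ≤ K := Nat.lt_succ_iff.1 k.2
    -- Over `range k` the product splits at `k₀` into a block of `b`, the single factor `t`, and a
    -- block of `a`.
    have e1 : ∏ j ∈ Finset.univ.filter (fun j : Fin K => (j : ℕ) < (k : ℕ)), z t j
        = ∏ n ∈ Finset.range k, (if n < (k₀ : ℕ) then b else if n = k₀ then t else a) := by
      refine Finset.prod_bij (fun j _ => (j : ℕ)) ?_ ?_ ?_ ?_
      · intro j hj; simpa using hj
      · intro i _ j _ hij; exact Fin.ext hij
      · intro n hn
        have hn' := Finset.mem_range.1 hn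
        exact ⟨⟨n, by omega⟩, by simpa using hn', rfl⟩
      · intro j _
        simp only [z, Fin.lt_def, Fin.ext_iff]
    rw [e1]
    split_ifs with hlt
    · obtain ⟨n, hn⟩ := Nat.exists_eq_add_of_lt hlt
      rw [hn, show (k₀ : ℕ) + n + 1 = k₀ + (n + 1) by omega, Finset.prod_range_add,
        Finset.prod_range_succ']
      have p1 : ∏ m ∈ Finset.range (k₀ : ℕ),
          (if m < (k₀ : ℕ) then b else if m = k₀ then t else a) = b ^ (k₀ : ℕ) := by
        rw [Finset.prod_congr rfl (g := fun _ => b)]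
        · simp
        · intro m hm; simp [Finset.mem_range.1 hm]
      have p2 : ∏ m ∈ Finset.range n, (if (k₀ : ℕ) + (m + 1) < (k₀ : ℕ) then b
          else if (k₀ : ℕ) + (m + 1) = k₀ then t else a) = a ^ n := by
        rw [Finset.prod_congr rfl (g := fun _ => a)]
        · simp
        · intro m _; rw [if_neg (by omega), if_neg (by omega)]
      rw [p1, p2, show (k₀ : ℕ) + (n + 1) - k₀ - 1 = n by omega]
      simp; ring
    · rw [Finset.prod_congr rfl (g := fun _ => b)]
      · simp
      · intro m hm
        have := Finset.mem_range.1 hm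
        rw [if_pos (by omega)]
  have hdiff : genFreqResponse h (z t₁) - genFreqResponse h (z t₂)
      = (t₁ - t₂) * partialResponse h k₀ a b := by
    rw [genFreqResponse, genFreqResponse, partialResponse, ← Finset.sum_sub_distrib,
      Finset.mul_sum]
    refine Finset.sum_congr rfl fun k _ => ?_
    rw [hprod, hprod]
    split_ifs <;> ring
  have := hg (z t₁) (z t₂) (hz _ ht₁) (hz _ ht₂)
  rw [hdiff, hnorm, abs_mul, mul_comm C_g] at this
  exact le_of_mul_le_mul_left this (abs_pos.2 (sub_ne_zero.2 hne))

/-- A filter over a constant symmetric shift operator is bounded by its frequency response. -/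
lemma l2norm_graphFilter_const_le {Λ : Set ℝ} {h : Fin (K + 1) → ℝ} {C : ℝ} (hC : 0 ≤ C)
    (hU : ∀ lam ∈ Λ, |freqResponse h lam| ≤ C) {S : Matrix V V ℝ} (hS : S.IsHermitian)
    (hΛ : spectrum ℝ S ⊆ Λ) (x : V → ℝ) :
    l2norm (graphFilter h (fun _ => S) x) ≤ C * l2norm x := by
  obtain ⟨W, d, hW, hW', rfl, hd⟩ := exists_orthogonal_diagonalization hS
  -- With all shifts equal, the filter is the polynomial `h(S)`, diagonal in the eigenbasis.
  have e : graphFilter h (fun _ : Fin K => W * Matrix.diagonal d * W.transpose) x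
      = W.mulVec ((Matrix.diagonal fun i => freqResponse h (d i)).mulVec
          (W.transpose.mulVec x)) := by
    have hdiag : (Matrix.diagonal fun i => freqResponse h (d i))
        = ∑ k : Fin (K + 1), h k • Matrix.diagonal (fun i => d i ^ (k : ℕ)) := by
      ext i j
      by_cases hij : i = j
      · subst hij; simp [Matrix.sum_apply, freqResponse]
      · simp [Matrix.sum_apply, hij]
    rw [hdiag, Matrix.mulVec_mulVec, Matrix.mulVec_mulVec, Matrix.mul_sum, Matrix.sum_mul,
      Matrix.sum_mulVec, graphFilter]
    refine Finset.sum_congr rfl fun k _ => ?_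
    rw [diffusion_const, conj_diagonal_pow hW hW']
    simp only [Matrix.mul_smul, Matrix.smul_mul, Matrix.smul_mulVec]
  rw [e, l2norm_mulVec_of_orthogonal hW]
  refine (l2norm_le_mul_of_abs_le hC (z := W.transpose.mulVec x) fun v => ?_).trans_eq ?_
  · rw [Matrix.mulVec_diagonal, abs_mul]
    exact mul_le_mul_of_nonneg_right (hU _ (hΛ (hd v))) (abs_nonneg _)
  · rw [l2norm_mulVec_of_orthogonal (by simpa using hW')]

/-- The effect of perturbing a single shift operator of a filter. -/
lemma l2norm_graphFilter_update_sub_le {Λ : Set ℝ} {h : Fin (K + 1) → ℝ} {C_g : ℝ}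
    {k₀ : Fin K} (hg : ∀ a ∈ Λ, ∀ b ∈ Λ, |partialResponse h k₀ a b| ≤ C_g)
    {S : Matrix V V ℝ} (hS : S.IsHermitian)
    (hΛ : spectrum ℝ S ⊆ Λ) (E : Matrix V V ℝ) {r : ℝ} (hr : 0 ≤ r) (hE : frobSq E ≤ r ^ 2)
    (x : V → ℝ) :
    l2norm (graphFilter h (Function.update (fun _ => S) k₀ (S + E)) x
      - graphFilter h (fun _ => S) x) ≤ |C_g| * r * l2norm x := by
  obtain ⟨W, d, hW, hW', hSW, hd⟩ := exists_orthogonal_diagonalization hS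
  set E' := W.transpose * E * W with hE'
  -- The difference of the filters in the eigenbasis: each summand `S ^ m * E * S ^ k₀` scales entry
  -- `(i, j)` of `E'` by `d i ^ m * d j ^ k₀`, so the sum is a Schur product with the partial
  -- response.
  let Z : Matrix V V ℝ := Matrix.of fun i j => partialResponse h k₀ (d i) (d j) * E' i j
  have hEE' : E = W * E' * W.transpose := by
    calc E = (W * W.transpose) * E * (W * W.transpose) := by rw [hW']; simp
      _ = _ := by rw [hE']; simp only [Matrix.mul_assoc]
  have e : graphFilter h (Function.update (fun _ => S) k₀ (S + E)) x
      - graphFilter h (fun _ => S) x = (W * Z * W.transpose).mulVec x := by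
    have hZ : Z = ∑ k : Fin (K + 1), h k • (if (k₀ : ℕ) < k then
        Matrix.diagonal (fun i => d i ^ ((k : ℕ) - k₀ - 1)) * E'
          * Matrix.diagonal (fun i => d i ^ (k₀ : ℕ)) else 0) := by
      ext i j
      simp only [Z, Matrix.of_apply, Matrix.sum_apply, partialResponse, Finset.sum_mul,
        Matrix.smul_apply, smul_eq_mul]
      refine Finset.sum_congr rfl fun k _ => ?_
      split_ifs
      · rw [Matrix.mul_diagonal, Matrix.diagonal_mul]; ring
      · simp
    rw [hZ, Matrix.mul_sum, Matrix.sum_mul, Matrix.sum_mulVec, graphFilter, graphFilter,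
      ← Finset.sum_sub_distrib]
    refine Finset.sum_congr rfl fun k _ => ?_
    rw [diffusion_update, diffusion_const, smul_add, add_sub_cancel_left, Matrix.mul_smul,
      Matrix.smul_mul, Matrix.smul_mulVec]
    congr 2
    split_ifs
    · rw [hSW, conj_diagonal_pow hW hW', conj_diagonal_pow hW hW', hEE']
      have hc : ∀ X : Matrix V V ℝ, W.transpose * (W * X) = X := fun X => by
        rw [← Matrix.mul_assoc, hW, Matrix.one_mul]
      simp only [Matrix.mul_assoc, hc]
    · simp
  have hfrob : frobSq Z ≤ C_g ^ 2 * frobSq E := by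
    rw [hEE', frobSq_conj hW, frobSq, frobSq, Finset.mul_sum]
    refine Finset.sum_le_sum fun i _ => ?_
    rw [Finset.mul_sum]
    refine Finset.sum_le_sum fun j _ => ?_
    simp only [Z, Matrix.of_apply, mul_pow]
    refine mul_le_mul_of_nonneg_right ?_ (sq_nonneg _)
    exact sq_le_sq.2 ((hg _ (hΛ (hd i)) _ (hΛ (hd j))).trans (le_abs_self _))
  rw [e]
  refine (sq_le_sq₀ (l2norm_nonneg _)
    (mul_nonneg (mul_nonneg (abs_nonneg _) hr) (l2norm_nonneg x))).1 ?_
  rw [mul_pow, mul_pow, sq_abs]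
  refine (l2norm_mulVec_sq_le _ _).trans (mul_le_mul_of_nonneg_right ?_ (sq_nonneg _))
  rw [frobSq_conj hW]
  exact hfrob.trans (mul_le_mul_of_nonneg_left hE (sq_nonneg _))

end Filter

/-- The coefficients of a filter are controlled by its responses on a set that contains `0`
and a number of absolute value at least `1`. -/
lemma abs_coeff_le {K : ℕ} {Λ : Set ℝ} {h : Fin (K + 1) → ℝ} {C_U C_g : ℝ}
    (hU : ∀ lam ∈ Λ, |freqResponse h lam| ≤ C_U)
    (hg : ∀ k₀ : Fin K, ∀ a ∈ Λ, ∀ b ∈ Λ, |partialResponse h k₀ a b| ≤ C_g)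
    (h0 : (0 : ℝ) ∈ Λ) {a : ℝ} (ha : a ∈ Λ) (ha1 : 1 ≤ |a|) (k : Fin (K + 1)) :
    |h k| ≤ |C_U| + |C_g| := by
  refine Fin.cases ?_ (fun k₀ => ?_) k
  · have := hU 0 h0
    have e : freqResponse h 0 = h 0 := by
      rw [freqResponse, Fin.sum_univ_succ]; simp
    rw [e] at this
    linarith [le_abs_self C_U, abs_nonneg C_g]
  · have := hg k₀ 0 h0 a ha
    -- Setting the variables after `k₀` to 0 kills every term except `k = k₀ + 1`, where the
    -- exponent of 0 is 0.
    have e : partialResponse h k₀ 0 a = h k₀.succ * a ^ (k₀ : ℕ) := by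
      rw [partialResponse, Finset.sum_eq_single k₀.succ]
      · simp
      · intro k _ hk
        split_ifs with hlt
        · have : (k : ℕ) - k₀ - 1 ≠ 0 := fun h0 => hk (Fin.ext (by simp; omega))
          simp [this]
        · simp
      · simp
    rw [e, abs_mul, abs_pow] at this
    have h1 : |h k₀.succ| * 1 ≤ |h k₀.succ| * |a| ^ (k₀ : ℕ) :=
      mul_le_mul_of_nonneg_left (one_le_pow₀ ha1) (abs_nonneg _)
    linarith [le_abs_self C_g, abs_nonneg C_U]

/-! ### Propagation of bounds through the layers -/

section Network
variable {V : Type*} [Fintype V] {L F K : ℕ} {σ : ℝ → ℝ} {c : ℝ}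

lemma l2norm_comp_sub_le (hc : 0 ≤ c) (hσ : ∀ a b, |σ a - σ b| ≤ c * |a - b|) (y z : V → ℝ) :
    l2norm ((fun v => σ (y v)) - fun v => σ (z v)) ≤ c * l2norm (y - z) :=
  l2norm_le_mul_of_abs_le hc fun v => hσ (y v) (z v)

lemma l2norm_comp_le (hc : 0 ≤ c) (hσ : ∀ a b, |σ a - σ b| ≤ c * |a - b|) (hσ0 : σ 0 = 0)
    (y : V → ℝ) : l2norm (fun v => σ (y v)) ≤ c * l2norm y :=
  l2norm_le_mul_of_abs_le hc fun v => by simpa [hσ0] using hσ (y v) 0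

lemma features_zero (h : FilterIdx L F → Fin (K + 1) → ℝ)
    (S : FilterIdx L F → Fin K → Matrix V V ℝ) (x : V → ℝ) (f : Fin F) :
    features σ h S x 0 f = fun v => σ (graphFilter (h (.input f)) (S (.input f)) x v) := rfl

lemma features_succ (h : FilterIdx L F → Fin (K + 1) → ℝ)
    (S : FilterIdx L F → Fin K → Matrix V V ℝ) (x : V → ℝ) (l : Fin (L - 2)) (f : Fin F) :
    features σ h S x l.succ f = fun v => σ ((∑ g, graphFilter (h (.hidden l f g))
      (S (.hidden l f g)) (features σ h S x l.castSucc g)) v) := by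
  funext v
  rw [Finset.sum_apply]
  rfl

lemma sgnn_eq (h : FilterIdx L F → Fin (K + 1) → ℝ)
    (S : FilterIdx L F → Fin K → Matrix V V ℝ) (x : V → ℝ) :
    sgnn σ h S x = fun v => σ ((∑ g, graphFilter (h (.output g)) (S (.output g))
      (features σ h S x (Fin.last (L - 2)) g)) v) := by
  funext v
  rw [Finset.sum_apply]
  rfl

variable {h : FilterIdx L F → Fin (K + 1) → ℝ} {S S' : FilterIdx L F → Fin K → Matrix V V ℝ}
  {D d : ℝ}

lemma l2norm_features_le (hc : 0 ≤ c) (hσ : ∀ a b, |σ a - σ b| ≤ c * |a - b|) (hσ0 : σ 0 = 0)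
    (hD : 0 ≤ D) (hS : ∀ i y, l2norm (graphFilter (h i) (S i) y) ≤ D * l2norm y) (x : V → ℝ)
    (m : Fin (L - 2 + 1)) (f : Fin F) :
    l2norm (features σ h S x m f) ≤ c * D * (c * F * D) ^ (m : ℕ) * l2norm x := by
  induction m using Fin.induction generalizing f with
  | zero =>
    rw [features_zero]
    refine (l2norm_comp_le hc hσ hσ0 _).trans ?_
    have := mul_le_mul_of_nonneg_left (hS (.input f) x) hc
    simpa [mul_assoc] using this
  | succ l ih =>
    rw [features_succ]
    refine (l2norm_comp_le hc hσ hσ0 _).trans ?_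
    calc _ ≤ c * ∑ _g : Fin F, D * (c * D * (c * F * D) ^ (l : ℕ) * l2norm x) := by
          refine mul_le_mul_of_nonneg_left ((l2norm_sum_le _ _).trans ?_) hc
          exact Finset.sum_le_sum fun g _ => (hS _ _).trans
            (mul_le_mul_of_nonneg_left (by simpa using ih g) hD)
      _ = _ := by
          simp [pow_succ]; ring

lemma l2norm_sgnn_le (hc : 0 ≤ c) (hσ : ∀ a b, |σ a - σ b| ≤ c * |a - b|) (hσ0 : σ 0 = 0)
    (hD : 0 ≤ D) (hS : ∀ i y, l2norm (graphFilter (h i) (S i) y) ≤ D * l2norm y) (x : V → ℝ) :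
    l2norm (sgnn σ h S x) ≤ c * F * D * (c * D * (c * F * D) ^ (L - 2)) * l2norm x := by
  rw [sgnn_eq]
  refine (l2norm_comp_le hc hσ hσ0 _).trans ?_
  calc _ ≤ c * ∑ _g : Fin F, D * (c * D * (c * F * D) ^ (L - 2) * l2norm x) := by
        refine mul_le_mul_of_nonneg_left ((l2norm_sum_le _ _).trans ?_) hc
        refine Finset.sum_le_sum fun g _ => (hS _ _).trans (mul_le_mul_of_nonneg_left ?_ hD)
        simpa using l2norm_features_le hc hσ hσ0 hD hS x (Fin.last (L - 2)) g
    _ = _ := by simp; ring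

/-- A layer with unperturbed filters propagates the differences of the features. -/
lemma sum_l2norm_features_succ_sub_le (hc : 0 ≤ c) (hσ : ∀ a b, |σ a - σ b| ≤ c * |a - b|)
    (hS : ∀ i y, l2norm (graphFilter (h i) (S i) y) ≤ D * l2norm y) (x : V → ℝ)
    (l : Fin (L - 2)) (heq : ∀ f g, S' (.hidden l f g) = S (.hidden l f g)) :
    ∑ f, l2norm (features σ h S' x l.succ f - features σ h S x l.succ f)
      ≤ c * F * D * ∑ f, l2norm (features σ h S' x l.castSucc f
          - features σ h S x l.castSucc f) := by
  calc _ ≤ ∑ _f : Fin F, c * ∑ g, D * l2norm (features σ h S' x l.castSucc g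
          - features σ h S x l.castSucc g) := by
        refine Finset.sum_le_sum fun f _ => ?_
        rw [features_succ, features_succ]
        refine (l2norm_comp_sub_le hc hσ _ _).trans (mul_le_mul_of_nonneg_left ?_ hc)
        rw [← Finset.sum_sub_distrib]
        refine (l2norm_sum_le _ _).trans (Finset.sum_le_sum fun g _ => ?_)
        rw [heq, ← graphFilter_sub]
        exact hS _ _
    _ = _ := by simp only [← Finset.mul_sum]; simp; ring

/-- An output layer with unperturbed filters propagates the differences of the features. -/
lemma l2norm_sgnn_sub_le_of_output_eq (hc : 0 ≤ c) (hσ : ∀ a b, |σ a - σ b| ≤ c * |a - b|)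
    (hS : ∀ i y, l2norm (graphFilter (h i) (S i) y) ≤ D * l2norm y) (x : V → ℝ)
    (heq : ∀ g, S' (.output g) = S (.output g)) :
    l2norm (sgnn σ h S' x - sgnn σ h S x)
      ≤ c * D * ∑ f, l2norm (features σ h S' x (Fin.last (L - 2)) f
          - features σ h S x (Fin.last (L - 2)) f) := by
  rw [sgnn_eq, sgnn_eq]
  refine (l2norm_comp_sub_le hc hσ _ _).trans ?_
  rw [mul_assoc]
  refine mul_le_mul_of_nonneg_left ?_ hc
  rw [← Finset.sum_sub_distrib, Finset.mul_sum]
  refine (l2norm_sum_le _ _).trans (Finset.sum_le_sum fun g _ => ?_)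
  rw [heq, ← graphFilter_sub]
  exact hS _ _

/-- The weight by which the effect of a perturbed filter is damped: a filter of a hidden layer
affects one of `F` features, and reads another one of `F` features. -/
def FilterIdx.weight : FilterIdx L F → ℝ
  | .input _ => 1
  | .hidden _ _ _ => F
  | .output _ => 1

/-- The tracked quantity is the sum over features of the differences. Only feature `f₀` is disturbed
in the first layer, so that layer costs no factor `F`; each hidden layer costs `c * F * D`, and the
single-feature output only `c * D`. -/
lemma l2norm_sgnn_sub_le_input (hc : 0 ≤ c) (hσ : ∀ a b, |σ a - σ b| ≤ c * |a - b|)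
    (hD : 0 ≤ D) (hS : ∀ i y, l2norm (graphFilter (h i) (S i) y) ≤ D * l2norm y)
    (x : V → ℝ) (f₀ : Fin F) (hne : ∀ i, i ≠ .input f₀ → S' i = S i)
    (hd : ∀ y, l2norm (graphFilter (h (.input f₀)) (S' (.input f₀)) y
      - graphFilter (h (.input f₀)) (S (.input f₀)) y) ≤ d * l2norm y) :
    l2norm (sgnn σ h S' x - sgnn σ h S x)
      ≤ c * d * (c * D) * (c * F * D) ^ (L - 2) * l2norm x := by
  have key : ∀ m : Fin (L - 2 + 1),
      ∑ f, l2norm (features σ h S' x m f - features σ h S x m f)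
        ≤ c * d * (c * F * D) ^ (m : ℕ) * l2norm x := by
    intro m
    induction m using Fin.induction with
    | zero =>
      rw [Finset.sum_eq_single f₀]
      · rw [features_zero, features_zero]
        refine (l2norm_comp_sub_le hc hσ _ _).trans ?_
        have := mul_le_mul_of_nonneg_left (hd x) hc
        simpa [mul_assoc] using this
      · intro f _ hf
        rw [features_zero, features_zero, hne _ (by simpa using hf)]
        simp
      · simp
    | succ l ih =>
      refine (sum_l2norm_features_succ_sub_le hc hσ hS x l fun f g => hne _ (by simp)).trans ?_
      refine (mul_le_mul_of_nonneg_left ih (by positivity)).trans_eq ?_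
      simp [pow_succ]; ring
  refine (l2norm_sgnn_sub_le_of_output_eq hc hσ hS x fun g => hne _ (by simp)).trans ?_
  refine (mul_le_mul_of_nonneg_left (key _) (by positivity)).trans_eq ?_
  simp; ring

/-- The perturbed layer changes one output feature through one input channel, so it lacks the factor
`F` of an ordinary hidden layer. The factor `F` on the left restores it, giving the same right-hand
side for every position of the filter. -/
lemma l2norm_sgnn_sub_le_hidden (hc : 0 ≤ c) (hσ : ∀ a b, |σ a - σ b| ≤ c * |a - b|)
    (hσ0 : σ 0 = 0)
    (hD : 0 ≤ D) (hS : ∀ i y, l2norm (graphFilter (h i) (S i) y) ≤ D * l2norm y) (hd0 : 0 ≤ d)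
    (x : V → ℝ) (l₀ : Fin (L - 2)) (f₀ g₀ : Fin F)
    (hne : ∀ i, i ≠ .hidden l₀ f₀ g₀ → S' i = S i)
    (hd : ∀ y, l2norm (graphFilter (h (.hidden l₀ f₀ g₀)) (S' (.hidden l₀ f₀ g₀)) y
      - graphFilter (h (.hidden l₀ f₀ g₀)) (S (.hidden l₀ f₀ g₀)) y) ≤ d * l2norm y) :
    F * l2norm (sgnn σ h S' x - sgnn σ h S x)
      ≤ c * d * (c * D) * (c * F * D) ^ (L - 2) * l2norm x := by
  -- Index `l₀.castSucc` is the layer read by the perturbed filter, `l₀.succ` the one it writes: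
  -- features agree up to the former and differ only beyond it.
  have key : ∀ m : Fin (L - 2 + 1),
      (m ≤ l₀.castSucc → features σ h S' x m = features σ h S x m) ∧
      (l₀.castSucc < m → F * ∑ f, l2norm (features σ h S' x m f - features σ h S x m f)
        ≤ c * d * (c * F * D) ^ (m : ℕ) * l2norm x) := by
    intro m
    induction m using Fin.induction with
    | zero =>
      refine ⟨fun _ => ?_, fun hlt => absurd hlt (Fin.not_lt_zero _)⟩
      funext f
      rw [features_zero, features_zero, hne _ (by simp)]
    | succ l ih =>
      refine ⟨fun hle => ?_, fun hlt => ?_⟩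
      · have hl : l < l₀ := by
          have := Fin.le_def.1 hle
          rw [Fin.val_succ, Fin.val_castSucc] at this
          exact Fin.lt_def.2 this
        funext f
        rw [features_succ, features_succ, ih.1 (Fin.castSucc_le_castSucc_iff.2 hl.le)]
        have : ∀ g, S' (.hidden l f g) = S (.hidden l f g) := fun g => hne _ (by
          simp [hl.ne])
        simp only [this]
      · have hle : l₀ ≤ l := by
          have := Fin.lt_def.1 hlt
          rw [Fin.val_succ, Fin.val_castSucc] at this
          exact Fin.le_def.2 (Nat.lt_succ_iff.1 this)
        rcases hle.eq_or_lt with rfl | hl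
        · have hf := ih.1 le_rfl
          have hsum : ∑ f, l2norm (features σ h S' x l₀.succ f - features σ h S x l₀.succ f)
              ≤ c * (d * (c * D * (c * F * D) ^ (l₀ : ℕ) * l2norm x)) := by
            rw [Finset.sum_eq_single f₀]
            · rw [features_succ, features_succ, hf]
              refine (l2norm_comp_sub_le hc hσ _ _).trans (mul_le_mul_of_nonneg_left ?_ hc)
              rw [← Finset.sum_sub_distrib, Finset.sum_eq_single g₀]
              · refine (hd _).trans (mul_le_mul_of_nonneg_left ?_ hd0)
                simpa using l2norm_features_le hc hσ hσ0 hD hS x l₀.castSucc g₀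
              · intro g _ hg
                rw [hne _ (by simpa using hg), sub_self]
              · simp
            · intro f _ hff
              have : ∀ g, S' (.hidden l₀ f g) = S (.hidden l₀ f g) := fun g => hne _ (by
                simp [hff])
              rw [features_succ, features_succ, hf]
              simp only [this, sub_self, l2norm_zero]
            · simp
          refine (mul_le_mul_of_nonneg_left hsum (Nat.cast_nonneg F)).trans_eq ?_
          simp [pow_succ]; ring
        · have h1 := sum_l2norm_features_succ_sub_le (S' := S') hc hσ hS x l fun f g =>
            hne _ (by simp [hl.ne'])
          have h2 := ih.2 (Fin.castSucc_lt_castSucc_iff.2 hl)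
          calc _ ≤ (F : ℝ) * (c * F * D * ∑ f, l2norm (features σ h S' x l.castSucc f
                  - features σ h S x l.castSucc f)) :=
                mul_le_mul_of_nonneg_left h1 (Nat.cast_nonneg F)
            _ = c * F * D * (F * ∑ f, l2norm (features σ h S' x l.castSucc f
                  - features σ h S x l.castSucc f)) := by ring
            _ ≤ c * F * D * (c * d * (c * F * D) ^ (l : ℕ) * l2norm x) :=
                mul_le_mul_of_nonneg_left (by simpa using h2) (by positivity)
            _ = _ := by simp [pow_succ]; ring
  have h1 := l2norm_sgnn_sub_le_of_output_eq (S' := S') hc hσ hS x fun g => hne _ (by simp)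
  have h2 := (key (Fin.last _)).2 (Fin.castSucc_lt_last l₀)
  calc _ ≤ (F : ℝ) * (c * D * ∑ f, l2norm (features σ h S' x (Fin.last (L - 2)) f
          - features σ h S x (Fin.last (L - 2)) f)) :=
        mul_le_mul_of_nonneg_left h1 (Nat.cast_nonneg F)
    _ = c * D * (F * ∑ f, l2norm (features σ h S' x (Fin.last (L - 2)) f
          - features σ h S x (Fin.last (L - 2)) f)) := by ring
    _ ≤ c * D * (c * d * (c * F * D) ^ (L - 2) * l2norm x) :=
        mul_le_mul_of_nonneg_left (by simpa using h2) (by positivity)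
    _ = _ := by ring

/-- All features are unchanged, and a single summand of the output layer differs. -/
lemma l2norm_sgnn_sub_le_output (hc : 0 ≤ c) (hσ : ∀ a b, |σ a - σ b| ≤ c * |a - b|)
    (hσ0 : σ 0 = 0)
    (hD : 0 ≤ D) (hS : ∀ i y, l2norm (graphFilter (h i) (S i) y) ≤ D * l2norm y) (hd0 : 0 ≤ d)
    (x : V → ℝ) (g₀ : Fin F) (hne : ∀ i, i ≠ .output g₀ → S' i = S i)
    (hd : ∀ y, l2norm (graphFilter (h (.output g₀)) (S' (.output g₀)) y
      - graphFilter (h (.output g₀)) (S (.output g₀)) y) ≤ d * l2norm y) :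
    l2norm (sgnn σ h S' x - sgnn σ h S x)
      ≤ c * d * (c * D) * (c * F * D) ^ (L - 2) * l2norm x := by
  have hf : ∀ m, features σ h S' x m = features σ h S x m := by
    intro m
    induction m using Fin.induction with
    | zero => funext f; rw [features_zero, features_zero, hne _ (by simp)]
    | succ l ih =>
      funext f
      have : ∀ g, S' (.hidden l f g) = S (.hidden l f g) := fun g => hne _ (by simp)
      rw [features_succ, features_succ, ih]
      simp only [this]
  rw [sgnn_eq, sgnn_eq, hf]
  refine (l2norm_comp_sub_le hc hσ _ _).trans ?_
  rw [← Finset.sum_sub_distrib, Finset.sum_eq_single g₀]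
  · have h1 := l2norm_features_le hc hσ hσ0 hD hS x (Fin.last (L - 2)) g₀
    calc _ ≤ c * (d * (c * D * (c * F * D) ^ (L - 2) * l2norm x)) :=
          mul_le_mul_of_nonneg_left ((hd _).trans
            (mul_le_mul_of_nonneg_left (by simpa using h1) hd0)) hc
      _ = _ := by ring
  · intro g _ hg
    rw [hne _ (by simpa using hg), sub_self]
  · simp

/-- The effect on the output of a perturbation of a single filter. -/
lemma weight_mul_l2norm_sgnn_sub_le (hc : 0 ≤ c) (hσ : ∀ a b, |σ a - σ b| ≤ c * |a - b|)
    (hσ0 : σ 0 = 0)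
    (hD : 0 ≤ D) (hS : ∀ i y, l2norm (graphFilter (h i) (S i) y) ≤ D * l2norm y) (hd0 : 0 ≤ d)
    (x : V → ℝ) (i₀ : FilterIdx L F) (hne : ∀ i, i ≠ i₀ → S' i = S i)
    (hd : ∀ y, l2norm (graphFilter (h i₀) (S' i₀) y - graphFilter (h i₀) (S i₀) y)
      ≤ d * l2norm y) :
    i₀.weight * l2norm (sgnn σ h S' x - sgnn σ h S x)
      ≤ c * d * (c * D) * (c * F * D) ^ (L - 2) * l2norm x := by
  cases i₀ with
  | input f₀ =>
    simpa [FilterIdx.weight] using l2norm_sgnn_sub_le_input hc hσ hD hS x f₀ hne hd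
  | hidden l f g => exact l2norm_sgnn_sub_le_hidden hc hσ hσ0 hD hS hd0 x l f g hne hd
  | output g =>
    simpa [FilterIdx.weight] using l2norm_sgnn_sub_le_output hc hσ hσ0 hD hS hd0 x g hne hd

end Network

/-- The filters of the three kinds of layers, as a sum of types. -/
def FilterIdx.equivSum (L F : ℕ) :
    (Fin F ⊕ (Fin (L - 2) × Fin F × Fin F)) ⊕ Fin F ≃ FilterIdx L F where
  toFun
    | .inl (.inl f) => .input f
    | .inl (.inr (l, f, g)) => .hidden l f g
    | .inr g => .output g
  invFun
    | .input f => .inl (.inl f)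
    | .hidden l f g => .inl (.inr (l, f, g))
    | .output g => .inr g
  left_inv := by rintro ((f | ⟨l, f, g⟩) | g) <;> rfl
  right_inv := by rintro (f | ⟨l, f, g⟩ | g) <;> rfl

instance FilterIdx.instFintype (L F : ℕ) : Fintype (FilterIdx L F) :=
  Fintype.ofEquiv _ (FilterIdx.equivSum L F)

lemma FilterIdx.weight_pos {L F : ℕ} (i : FilterIdx L F) : 0 < i.weight := by
  cases i with
  | input f => exact one_pos
  | hidden l f g => exact Nat.cast_pos.2 f.pos
  | output g => exact one_pos

/-- The `(L - 2) F²` hidden filters have inverse squared weight `F⁻²` and contribute only `L - 2`.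
The total `2F + L - 2` is at most `L F` once `F ≥ 1`. -/
lemma FilterIdx.sum_inv_weight_sq_le {L F : ℕ} (hL : 2 ≤ L) :
    ∑ i : FilterIdx L F, (i.weight ^ 2)⁻¹ ≤ L * F := by
  rw [← (FilterIdx.equivSum L F).sum_comp, Fintype.sum_sum_type, Fintype.sum_sum_type]
  simp only [FilterIdx.equivSum, Equiv.coe_fn_mk, FilterIdx.weight]
  obtain ⟨n, rfl⟩ := Nat.exists_eq_add_of_le hL
  rcases Nat.eq_zero_or_pos F with rfl | hF
  · simp
  · have hF' : (1 : ℝ) ≤ F := by exact_mod_cast hF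
    have : (F : ℝ) ≠ 0 := by positivity
    simp only [one_pow, inv_one, Finset.sum_const, Finset.card_univ, Fintype.card_fin,
      Fintype.card_prod, nsmul_eq_mul, mul_one]
    push_cast
    have e : ((2 + n - 2 : ℕ) : ℝ) = n := by simp
    rw [e, show (n : ℝ) * (F * F) * ((F : ℝ) ^ 2)⁻¹ = n by field_simp]
    nlinarith [(Nat.cast_nonneg n : (0 : ℝ) ≤ n)]

/-! ### Shift operators and single edges -/

section Graph
variable {V : Type*} [Fintype V]

open Classical in
lemma shiftOp_adjacency_apply (H : SimpleGraph V) (i j : V) :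
    shiftOp .adjacency H i j = if H.Adj i j then 1 else 0 := by
  simp [shiftOp, SimpleGraph.adjMatrix_apply]

open Classical in
lemma shiftOp_laplacian_apply (H : SimpleGraph V) (i j : V) :
    shiftOp .laplacian H i j
      = (if i = j then ∑ w, shiftOp .adjacency H i w else 0) - shiftOp .adjacency H i j := by
  simp only [shiftOp, SimpleGraph.lapMatrix, SimpleGraph.degMatrix, Matrix.sub_apply,
    Matrix.diagonal_apply]
  congr 2
  have := H.adjMatrix_mulVec_const_apply (α := ℝ) (a := 1) (v := i)
  simpa [Matrix.mulVec, dotProduct] using this.symm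

lemma shiftOp_isHermitian (s : ShiftKind) (H : SimpleGraph V) : (shiftOp s H).IsHermitian := by
  classical
  cases s with
  | adjacency =>
    ext i j
    simp [shiftOp_adjacency_apply, H.adj_comm]
  | laplacian =>
    ext i j
    by_cases hij : i = j
    · subst hij; simp
    · simp [shiftOp_laplacian_apply, shiftOp_adjacency_apply, H.adj_comm, hij, Ne.symm hij]

lemma shiftOp_bot (s : ShiftKind) : shiftOp s (⊥ : SimpleGraph V) = 0 := by
  classical
  cases s with
  | adjacency => ext i j; simp [shiftOp_adjacency_apply]
  | laplacian => ext i j; simp [shiftOp_laplacian_apply, shiftOp_adjacency_apply]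

/-- The shift operator is additive in the edge set. -/
lemma shiftOp_add (s : ShiftKind) {H H₁ H₂ : SimpleGraph V}
    (hor : ∀ a b, H.Adj a b ↔ H₁.Adj a b ∨ H₂.Adj a b)
    (hnot : ∀ a b, H₁.Adj a b → ¬ H₂.Adj a b) :
    shiftOp s H = shiftOp s H₁ + shiftOp s H₂ := by
  classical
  have hadj : shiftOp .adjacency H = shiftOp .adjacency H₁ + shiftOp .adjacency H₂ := by
    ext i j
    simp only [shiftOp_adjacency_apply, Matrix.add_apply, hor]
    by_cases h1 : H₁.Adj i j
    · simp [h1, hnot _ _ h1]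
    · simp [h1]
  cases s with
  | adjacency => exact hadj
  | laplacian =>
    ext i j
    simp only [shiftOp_laplacian_apply, Matrix.add_apply, hadj, Finset.sum_add_distrib]
    split_ifs <;> ring

open Classical in
lemma shiftOp_adjacency_edge {u v : V} (huv : u ≠ v) (i j : V) :
    shiftOp .adjacency (SimpleGraph.fromEdgeSet {s(u, v)}) i j
      = (if i = u then if j = v then 1 else 0 else 0)
        + (if i = v then if j = u then 1 else 0 else 0) := by
  rw [shiftOp_adjacency_apply]
  simp only [SimpleGraph.fromEdgeSet_adj, Set.mem_singleton_iff, Sym2.eq_iff]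
  grind

open Classical in
lemma shiftOp_laplacian_edge {u v : V} (huv : u ≠ v) (i j : V) :
    shiftOp .laplacian (SimpleGraph.fromEdgeSet {s(u, v)}) i j
      = ((if i = u then 1 else 0) - (if i = v then 1 else 0))
        * ((if j = u then 1 else 0) - (if j = v then 1 else 0)) := by
  rw [shiftOp_laplacian_apply]
  simp only [shiftOp_adjacency_edge huv, Finset.sum_add_distrib]
  have e : ∀ a b : V, ∑ w, (if i = a then if w = b then (1 : ℝ) else 0 else 0)
      = if i = a then 1 else 0 := fun a b => by
    split_ifs <;> simp
  rw [e, e]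
  grind

lemma ShiftKind.alpha_pos (s : ShiftKind) : 0 < s.alpha := by
  cases s <;> norm_num [ShiftKind.alpha]

/-- The source of `2α`: one edge gives two unit entries in the adjacency matrix and four entries
`±1` in the Laplacian. -/
lemma frobSq_shiftOp_edge (s : ShiftKind) {u v : V} (huv : u ≠ v) :
    frobSq (shiftOp s (SimpleGraph.fromEdgeSet {s(u, v)})) = 2 * s.alpha := by
  classical
  cases s with
  | adjacency =>
    have e : ∀ i j, shiftOp .adjacency (SimpleGraph.fromEdgeSet {s(u, v)}) i j ^ 2
        = (if i = u then if j = v then 1 else 0 else 0)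
          + (if i = v then if j = u then 1 else 0 else 0) := fun i j => by
      rw [shiftOp_adjacency_edge huv]
      grind
    simp only [frobSq, e, Finset.sum_add_distrib, ShiftKind.alpha]
    simp
    norm_num
  | laplacian =>
    have e : ∀ i j, shiftOp .laplacian (SimpleGraph.fromEdgeSet {s(u, v)}) i j ^ 2
        = ((if i = u then 1 else 0) + (if i = v then 1 else 0))
        * ((if j = u then 1 else 0) + (if j = v then 1 else 0)) := fun i j => by
      rw [shiftOp_laplacian_edge huv]
      grind
    simp only [frobSq, e, ← Finset.mul_sum, ← Finset.sum_mul, Finset.sum_add_distrib,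
      ShiftKind.alpha]
    simp
    norm_num

/-- A graph with a single edge has an eigenvalue of absolute value at least `1`. -/
lemma exists_mem_spectrum_shiftOp_edge [DecidableEq V] (s : ShiftKind) {u v : V} (huv : u ≠ v) :
    ∃ a ∈ spectrum ℝ (shiftOp s (SimpleGraph.fromEdgeSet {s(u, v)})), 1 ≤ |a| := by
  have key : ∀ (A : Matrix V V ℝ) (a : ℝ) (z : V → ℝ), z ≠ 0 → A.mulVec z = a • z →
      a ∈ spectrum ℝ A := by
    intro A a z hz hA
    rw [← Matrix.spectrum_toLin']
    refine Module.End.HasEigenvalue.mem_spectrum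
      (Module.End.hasEigenvalue_of_hasEigenvector (x := z) ⟨?_, hz⟩)
    rw [Module.End.mem_eigenspace_iff]
    simpa using hA
  -- The signal `e_u - e_v` is an eigenvector in both cases, with eigenvalue `-1` for the adjacency
  -- matrix and `2` for the Laplacian.
  let z : V → ℝ := fun w => (if w = u then 1 else 0) - (if w = v then 1 else 0)
  have hz : z ≠ 0 := fun h0 => by
    have := congrFun h0 u
    simp [z, huv] at this
  cases s with
  | adjacency =>
    refine ⟨-1, key _ _ z hz ?_, by simp⟩
    funext i
    have : ∀ j, shiftOp .adjacency (SimpleGraph.fromEdgeSet {s(u, v)}) i j * z j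
        = (if j = v then -(if i = u then 1 else 0) else 0)
          + (if j = u then (if i = v then 1 else 0) else 0) := fun j => by
      rw [shiftOp_adjacency_edge huv]
      simp only [z]
      grind
    simp only [Matrix.mulVec, dotProduct, this, Finset.sum_add_distrib]
    simp [z]
    ring
  | laplacian =>
    refine ⟨2, key _ _ z hz ?_, by norm_num⟩
    funext i
    have : ∀ j, shiftOp .laplacian (SimpleGraph.fromEdgeSet {s(u, v)}) i j * z j
        = z i * ((if j = u then 1 else 0) + (if j = v then 1 else 0)) := fun j => by
      rw [shiftOp_laplacian_edge huv]
      simp only [z]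
      grind
    simp only [Matrix.mulVec, dotProduct, this, ← Finset.mul_sum, Finset.sum_add_distrib]
    simp
    ring

/-- There are finitely many graphs on `V`. Taking `b ≥ 1` above the bound itself makes it at most `b
^ 2`. -/
lemma exists_frobSq_shiftOp_le (V : Type*) [Fintype V] (s : ShiftKind) :
    ∃ b : ℝ, 1 ≤ b ∧ ∀ H : SimpleGraph V, frobSq (shiftOp s H) ≤ b ^ 2 := by
  obtain ⟨C, hC⟩ := (Set.finite_range fun H : SimpleGraph V => frobSq (shiftOp s H)).bddAbove
  refine ⟨max 1 C, le_max_left _ _, fun H => ?_⟩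
  have h1 : frobSq (shiftOp s H) ≤ C := hC ⟨H, rfl⟩
  have h2 : (1 : ℝ) ≤ max 1 C := le_max_left _ _
  have h3 : C ≤ max 1 C := le_max_right _ _
  nlinarith

end Graph

/-! ### The nonlinearity -/

/-- A function that does not increase variances is `1`-Lipschitz: test it on the uniform law on
two points. -/
lemma VarianceNonincreasing.abs_sub_le {σ : ℝ → ℝ} (hv : VarianceNonincreasing σ)
    (hσ : Measurable σ) (a b : ℝ) : |σ a - σ b| ≤ |a - b| := by
  let ν : Measure ℝ := (2 : ENNReal)⁻¹ • (Measure.dirac a + Measure.dirac b)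
  have hν : IsProbabilityMeasure ν := ⟨by
    simp only [ν, Measure.smul_apply, Measure.add_apply, measure_univ, smul_eq_mul]
    rw [one_add_one_eq_two]
    exact ENNReal.inv_mul_cancel (by norm_num) (by norm_num)⟩
  have hint : ∀ f : ℝ → ℝ, Measurable f → Integrable f (Measure.dirac a + Measure.dirac b) :=
    fun f hf => Integrable.add_measure
      (integrable_dirac' hf.stronglyMeasurable (by simp))
      (integrable_dirac' hf.stronglyMeasurable (by simp))
  have hI : ∀ f : ℝ → ℝ, Measurable f → ∫ t, f t ∂ν = (f a + f b) / 2 := by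
    intro f hf
    rw [integral_smul_measure, integral_add_measure
      (integrable_dirac' hf.stronglyMeasurable (by simp))
      (integrable_dirac' hf.stronglyMeasurable (by simp)), integral_dirac, integral_dirac]
    simp
    ring
  have hmem : ∀ f : ℝ → ℝ, Measurable f → MemLp f 2 ν := by
    intro f hf
    rw [memLp_two_iff_integrable_sq hf.aestronglyMeasurable]
    exact (hint _ (hf.pow_const 2)).smul_measure (by simp)
  have hvar : ∀ f : ℝ → ℝ, Measurable f → variance f ν = (f a - f b) ^ 2 / 4 := by
    intro f hf
    rw [variance_eq_sub (hmem f hf), hI f hf]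
    have : ∫ t, (f ^ 2) t ∂ν = (f a ^ 2 + f b ^ 2) / 2 := by
      exact hI (f ^ 2) (hf.pow_const 2)
    rw [this]
    ring
  have := hv ν hν (hmem id measurable_id)
  rw [hvar σ hσ, hvar id measurable_id] at this
  simp only [id_eq] at this
  exact sq_le_sq.1 (by linarith)

/-! ### Variance of functions of independent events -/

section Variance
variable {V J Ω : Type*} [Fintype V] [Fintype J] [MeasurableSpace Ω] {μ : Measure Ω}

lemma memLp_comp_randomSet [IsFiniteMeasure μ] {A : Ω → Set J}
    (hA : ∀ j, MeasurableSet {ω | j ∈ A ω}) (f : Set J → ℝ) :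
    MemLp (fun ω => f (A ω)) 2 μ := by
  have hmeas : Measurable A := measurable_set_iff.2 fun j => measurableSet_setOfPred.1 (hA j)
  obtain ⟨C, hC⟩ := (Set.finite_range fun a => |f a|).bddAbove
  exact MemLp.of_bound ((measurable_of_finite f).comp hmeas).aestronglyMeasurable C
    (Filter.Eventually.of_forall fun ω => hC ⟨A ω, rfl⟩)

/-- The variance of a function of rare independent events is, to first order, the sum of the
squared effects of the single events. -/
lemma sum_variance_le [IsProbabilityMeasure μ] {A : Ω → Set J}
    (hA : ∀ j, MeasurableSet {ω | j ∈ A ω}) {q : ℝ}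
    (hq : ∀ j, μ.real {ω | j ∈ A ω} = q)
    (hqq : ∀ i j, i ≠ j → μ.real ({ω | i ∈ A ω} ∩ {ω | j ∈ A ω}) = q ^ 2)
    (Φ : Set J → V → ℝ) {B : ℝ} (hB0 : 0 ≤ B)
    (hB : ∀ a : Set J, a.Nonempty → l2norm (Φ a - Φ ∅) ^ 2 ≤ B) :
    ∑ v, variance (fun ω => Φ (A ω) v) μ
      ≤ q * ∑ j, l2norm (Φ {j} - Φ ∅) ^ 2 + q ^ 2 * ((Fintype.card J : ℝ) ^ 2 * B) := by
  classical
  let E : J → Set Ω := fun j => {ω | j ∈ A ω}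
  -- A pointwise majorant: a lone active element pays its exact effect, and two or more active
  -- elements pay `B` through some ordered pair of them.
  let g : Ω → ℝ := fun ω => ∑ j, (E j).indicator (fun _ => l2norm (Φ {j} - Φ ∅) ^ 2) ω
    + ∑ z ∈ (Finset.univ : Finset J).offDiag, (E z.1 ∩ E z.2).indicator (fun _ => B) ω
  have hpt : ∀ ω, l2norm (Φ (A ω) - Φ ∅) ^ 2 ≤ g ω := by
    intro ω
    have h1 : ∀ j ∈ (Finset.univ : Finset J),
        0 ≤ (E j).indicator (fun _ => l2norm (Φ {j} - Φ ∅) ^ 2) ω :=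
      fun j _ => Set.indicator_nonneg (fun _ _ => sq_nonneg _) ω
    have h2 : ∀ z ∈ (Finset.univ : Finset J).offDiag,
        0 ≤ (E z.1 ∩ E z.2).indicator (fun _ => B) ω :=
      fun z _ => Set.indicator_nonneg (fun _ _ => hB0) ω
    rcases (A ω).eq_empty_or_nonempty with he | ⟨j, hj⟩
    · rw [he]
      simpa using add_nonneg (Finset.sum_nonneg h1) (Finset.sum_nonneg h2)
    · by_cases hs : A ω = {j}
      · have := Finset.single_le_sum h1 (Finset.mem_univ j)
        rw [Set.indicator_of_mem (show ω ∈ E j from hj)] at this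
        rw [hs]
        exact this.trans (le_add_of_nonneg_right (Finset.sum_nonneg h2))
      · obtain ⟨i, hi, hij⟩ : ∃ i ∈ A ω, i ≠ j := by
          by_contra! hcon
          exact hs (Set.eq_singleton_iff_unique_mem.2 ⟨hj, hcon⟩)
        have := Finset.single_le_sum h2
          (show (i, j) ∈ (Finset.univ : Finset J).offDiag by simpa using hij)
        rw [Set.indicator_of_mem (show ω ∈ E i ∩ E j from ⟨hi, hj⟩)] at this
        exact ((hB _ ⟨j, hj⟩).trans this).trans
          (le_add_of_nonneg_left (Finset.sum_nonneg h1))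
  have hEi : ∀ (j : J) (t : ℝ), Integrable ((E j).indicator fun _ => t) μ :=
    fun j t => (integrable_const t).indicator (hA j)
  have hEEi : ∀ (z : J × J) (t : ℝ), Integrable ((E z.1 ∩ E z.2).indicator fun _ => t) μ :=
    fun z t => (integrable_const t).indicator ((hA _).inter (hA _))
  have hg1 : Integrable
      (fun ω => ∑ j, (E j).indicator (fun _ => l2norm (Φ {j} - Φ ∅) ^ 2) ω) μ :=
    integrable_finsetSum _ fun j _ => hEi j _
  have hg2 : Integrable (fun ω => ∑ z ∈ (Finset.univ : Finset J).offDiag,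
      (E z.1 ∩ E z.2).indicator (fun _ => B) ω) μ :=
    integrable_finsetSum _ fun z _ => hEEi z _
  have hgint : ∫ ω, g ω ∂μ ≤ q * ∑ j, l2norm (Φ {j} - Φ ∅) ^ 2
      + q ^ 2 * ((Fintype.card J : ℝ) ^ 2 * B) := by
    rw [integral_add hg1 hg2, integral_finsetSum _ fun j _ => hEi j _,
      integral_finsetSum _ fun z _ => hEEi z _, Finset.mul_sum]
    refine add_le_add (le_of_eq (Finset.sum_congr rfl fun j _ => ?_)) ?_
    · rw [integral_indicator_const _ (hA j), hq, smul_eq_mul]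
    · have e : ∀ z ∈ (Finset.univ : Finset J).offDiag,
          ∫ ω, (E z.1 ∩ E z.2).indicator (fun _ => B) ω ∂μ = q ^ 2 * B := by
        intro z hz
        rw [integral_indicator_const _ ((hA _).inter (hA _)),
          hqq _ _ (Finset.mem_offDiag.1 hz).2.2, smul_eq_mul]
      rw [Finset.sum_congr rfl e, Finset.sum_const, nsmul_eq_mul, Finset.offDiag_card,
        Finset.card_univ]
      have hcard : ((Fintype.card J * Fintype.card J - Fintype.card J : ℕ) : ℝ)
          ≤ (Fintype.card J : ℝ) ^ 2 := by
        rw [sq]; exact_mod_cast Nat.sub_le _ _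
      have := mul_le_mul_of_nonneg_right hcard (mul_nonneg (sq_nonneg q) hB0)
      linarith
  have hsq : ∀ v, Integrable (fun ω => (Φ (A ω) v - Φ ∅ v) ^ 2) μ := fun v =>
    (memLp_comp_randomSet hA fun a => Φ a v - Φ ∅ v).integrable_sq
  calc ∑ v, variance (fun ω => Φ (A ω) v) μ
      ≤ ∑ v, ∫ ω, (Φ (A ω) v - Φ ∅ v) ^ 2 ∂μ := by
        refine Finset.sum_le_sum fun v _ => ?_
        rw [← variance_sub_const
          (memLp_comp_randomSet hA fun a => Φ a v).aestronglyMeasurable (Φ ∅ v)]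
        exact variance_le_expectation_sq
          (memLp_comp_randomSet hA fun a => Φ a v - Φ ∅ v).aestronglyMeasurable
    _ = ∫ ω, ∑ v, (Φ (A ω) v - Φ ∅ v) ^ 2 ∂μ := (integral_finsetSum _ fun v _ => hsq v).symm
    _ ≤ ∫ ω, g ω ∂μ := by
        refine integral_mono (integrable_finsetSum _ fun v _ => hsq v) (hg1.add hg2) fun ω => ?_
        have := hpt ω
        rw [l2norm_sq] at this
        exact this
    _ ≤ _ := hgint

/-- Write `q = q(1-q) + q²` and absorb every `q²` using `1 ≤ 4(1-q)²`, valid for `q ≤ 1/2`. -/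
lemma sum_variance_le_of_le_half [IsProbabilityMeasure μ] {A : Ω → Set J}
    (hA : ∀ j, MeasurableSet {ω | j ∈ A ω}) {q : ℝ} (hq0 : 0 ≤ q) (hq2 : q ≤ 1 / 2)
    (hq : ∀ j, μ.real {ω | j ∈ A ω} = q)
    (hqq : ∀ i j, i ≠ j → μ.real ({ω | i ∈ A ω} ∩ {ω | j ∈ A ω}) = q ^ 2)
    (Φ : Set J → V → ℝ) {B C X : ℝ} (hB0 : 0 ≤ B) (hC0 : 0 ≤ C) (hX0 : 0 ≤ X)
    (hB : ∀ a : Set J, a.Nonempty → l2norm (Φ a - Φ ∅) ^ 2 ≤ B * X)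
    (hC : ∑ j, l2norm (Φ {j} - Φ ∅) ^ 2 ≤ C * X) :
    ∑ v, variance (fun ω => Φ (A ω) v) μ
      ≤ q * (1 - q) * C * X
        + 4 * (C + (Fintype.card J : ℝ) ^ 2 * B) * X * (q ^ 2 * (1 - q) ^ 2) := by
  have h1 := sum_variance_le hA hq hqq Φ (mul_nonneg hB0 hX0) hB
  have h2 := mul_le_mul_of_nonneg_left hC hq0
  have h3 : q ^ 2 * 1 ≤ q ^ 2 * (4 * (1 - q) ^ 2) :=
    mul_le_mul_of_nonneg_left (by nlinarith) (sq_nonneg q)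
  have h4 : 0 ≤ (C + (Fintype.card J : ℝ) ^ 2 * B) * X := by positivity
  have h5 := mul_le_mul_of_nonneg_right h3 h4
  linarith

end Variance

/-! ### The output as a function of the set of active edges -/

section Active
variable {V ι : Type*} (G : SimpleGraph V)

/-- The family of subgraphs of `G` with a given set of active edges. -/
def activeGraph (A : Set (ι × G.edgeSet)) (i : ι) : SimpleGraph V :=
  SimpleGraph.fromEdgeSet {e | ∃ he : e ∈ G.edgeSet, (i, ⟨e, he⟩) ∈ A}

variable {G}

lemma activeGraph_adj {A : Set (ι × G.edgeSet)} {i : ι} {a b : V} :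
    (activeGraph G A i).Adj a b ↔ ∃ h : G.Adj a b, (i, ⟨s(a, b), h⟩) ∈ A := by
  simp only [activeGraph, SimpleGraph.fromEdgeSet_adj, Set.mem_ofPred_eq]
  exact ⟨fun h => h.1, fun h => ⟨h, h.1.ne⟩⟩

lemma activeGraph_setOf_mem {𝒢 : ι → SimpleGraph V} (h𝒢 : ∀ i, 𝒢 i ≤ G) :
    activeGraph G {j : ι × G.edgeSet | (j.2 : Sym2 V) ∈ (𝒢 j.1).edgeSet} = 𝒢 := by
  funext i
  ext a b
  rw [activeGraph_adj]
  exact ⟨fun ⟨_, h⟩ => h, fun h => ⟨h𝒢 i h, h⟩⟩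

lemma activeGraph_empty (i : ι) : activeGraph G ∅ i = ⊥ := by
  ext a b
  simp [activeGraph_adj]

lemma activeGraph_univ (i : ι) : activeGraph G Set.univ i = G := by
  ext a b
  simp [activeGraph_adj]

lemma activeGraph_singleton_of_ne {j : ι × G.edgeSet} {i : ι} (h : i ≠ j.1) :
    activeGraph G {j} i = activeGraph G ∅ i := by
  ext a b
  simp only [activeGraph_adj, Set.mem_singleton_iff, Prod.ext_iff, h, false_and,
    Set.mem_empty_iff_false]

lemma activeGraph_compl_singleton_of_ne {j : ι × G.edgeSet} {i : ι} (h : i ≠ j.1) :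
    activeGraph G {j}ᶜ i = activeGraph G Set.univ i := by
  ext a b
  simp only [activeGraph_adj, Set.mem_compl_iff, Set.mem_singleton_iff, Prod.ext_iff, h,
    false_and, not_false_eq_true, Set.mem_univ]

lemma fromEdgeSet_singleton_le (e : G.edgeSet) :
    SimpleGraph.fromEdgeSet {(e : Sym2 V)} ≤ G := by
  intro a b h
  have h1 : s(a, b) = (e : Sym2 V) := by simpa using (SimpleGraph.fromEdgeSet_adj _).1 h |>.1
  have h2 := e.2
  rw [← h1] at h2
  exact h2

variable [Fintype V]

lemma shiftOp_activeGraph_singleton (s : ShiftKind) (j : ι × G.edgeSet) :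
    shiftOp s (activeGraph G {j} j.1)
      = shiftOp s (activeGraph G ∅ j.1) + shiftOp s (SimpleGraph.fromEdgeSet {(j.2 : Sym2 V)}) := by
  refine shiftOp_add s (fun a b => ?_) fun a b h => ?_
  · obtain ⟨i, e, he⟩ := j
    simp only [activeGraph_adj, SimpleGraph.fromEdgeSet_adj, Set.mem_singleton_iff,
      Prod.mk.injEq, true_and, Set.mem_empty_iff_false, exists_false, false_or]
    exact ⟨fun ⟨h, e⟩ => ⟨congrArg Subtype.val e, h.ne⟩,
      fun ⟨h, _⟩ => ⟨by rw [← h] at he; exact he, Subtype.ext h⟩⟩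
  · simp [activeGraph_adj] at h

lemma shiftOp_activeGraph_compl_singleton (s : ShiftKind) (j : ι × G.edgeSet) :
    shiftOp s (activeGraph G {j}ᶜ j.1) = shiftOp s (activeGraph G Set.univ j.1)
      + -shiftOp s (SimpleGraph.fromEdgeSet {(j.2 : Sym2 V)}) := by
  rw [← sub_eq_add_neg, eq_sub_iff_add_eq]
  obtain ⟨i, e, he⟩ := j
  refine (shiftOp_add s (fun a b => ?_) fun a b h => ?_).symm
  · simp only [activeGraph_adj, SimpleGraph.fromEdgeSet_adj, Set.mem_singleton_iff,
      Set.mem_compl_iff, Prod.mk.injEq, true_and, Set.mem_univ, exists_prop,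
      and_true]
    constructor
    · intro h
      by_cases h' : s(a, b) = e
      · exact Or.inr ⟨h', h.ne⟩
      · exact Or.inl ⟨h, fun e' => h' (congrArg Subtype.val e')⟩
    · rintro (h | h)
      · exact h.1
      · have := he
        rw [← h.1] at this
        exact this
  · simp only [activeGraph_adj, Set.mem_compl_iff, Set.mem_singleton_iff, Prod.mk.injEq,
      true_and] at h
    simp only [SimpleGraph.fromEdgeSet_adj, Set.mem_singleton_iff, not_and]
    exact fun h' => absurd (Subtype.ext h') h.2

lemma frobSq_shiftOp_edgeSet (s : ShiftKind) (e : G.edgeSet) :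
    frobSq (shiftOp s (SimpleGraph.fromEdgeSet {(e : Sym2 V)})) = 2 * s.alpha := by
  obtain ⟨e, he⟩ := e
  induction e using Sym2.ind with
  | _ u v => exact frobSq_shiftOp_edge s (SimpleGraph.Adj.ne he)

/-- The empty subgraph contributes 0 and the one-edge subgraph an eigenvalue bounded away from 0.
These points serve both the difference quotients and the coefficient bound. -/
lemma exists_mem_spectrum_of_edge [DecidableEq V] (s : ShiftKind) (e : G.edgeSet) {Λ : Set ℝ}
    (hΛ : ∀ H : SimpleGraph V, H ≤ G → spectrum ℝ (shiftOp s H) ⊆ Λ) :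
    (0 : ℝ) ∈ Λ ∧ ∃ a ∈ Λ, 1 ≤ |a| := by
  have hle := fromEdgeSet_singleton_le e
  obtain ⟨e, he⟩ := e
  induction e using Sym2.ind with
  | _ u v =>
    refine ⟨hΛ ⊥ bot_le ?_, ?_⟩
    · have : Nonempty V := ⟨u⟩
      rw [shiftOp_bot, spectrum.zero_eq]
      rfl
    · obtain ⟨a, ha, ha1⟩ := exists_mem_spectrum_shiftOp_edge s (SimpleGraph.Adj.ne he)
      exact ⟨a, hΛ _ hle ha, ha1⟩

end Active

/-! ### Perturbations of single shift operators -/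

section Perturbation
variable {V : Type*} [Fintype V] [DecidableEq V] {L F K : ℕ}

/-- The sum of the squared effects of the perturbations of the single shift operators. -/
lemma sum_sq_l2norm_sgnn_sub_le {T : Type*} [Fintype T] (hL : 2 ≤ L)
    {h : FilterIdx L F → Fin (K + 1) → ℝ} {σ : ℝ → ℝ} {c C_U C_g r : ℝ} (hc : 0 ≤ c)
    (hσ : ∀ a b, |σ a - σ b| ≤ c * |a - b|) (hσ0 : σ 0 = 0) {Λ : Set ℝ}
    (hU : ∀ i, ∀ lam ∈ Λ, |freqResponse (h i) lam| ≤ C_U)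
    (hg : ∀ i k₀, ∀ a ∈ Λ, ∀ b ∈ Λ, |partialResponse (h i) k₀ a b| ≤ C_g)
    {S₀ : Matrix V V ℝ} (hS₀ : S₀.IsHermitian) (hΛ : spectrum ℝ S₀ ⊆ Λ)
    (E : T → Matrix V V ℝ) (hr : 0 ≤ r) (hE : ∀ t, frobSq (E t) ≤ r ^ 2)
    (S' : (FilterIdx L F × Fin K) × T → FilterIdx L F → Fin K → Matrix V V ℝ)
    (hS' : ∀ j, S' j j.1.1 j.1.2 = S₀ + E j.2)
    (hne : ∀ j i k, (i, k) ≠ j.1 → S' j i k = S₀) (x : V → ℝ) :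
    ∑ j, l2norm (sgnn σ h (S' j) x - sgnn σ h (fun _ _ => S₀) x) ^ 2
      ≤ K * Fintype.card T * (L * F)
        * (c * (|C_g| * r) * (c * |C_U|) * (c * F * |C_U|) ^ (L - 2) * l2norm x) ^ 2 := by
  set β := c * (|C_g| * r) * (c * |C_U|) * (c * F * |C_U|) ^ (L - 2) * l2norm x with hβ
  have hterm : ∀ j : (FilterIdx L F × Fin K) × T,
      l2norm (sgnn σ h (S' j) x - sgnn σ h (fun _ _ => S₀) x) ^ 2
        ≤ (j.1.1.weight ^ 2)⁻¹ * β ^ 2 := by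
    rintro ⟨⟨i, k⟩, t⟩
    have hupd : S' ((i, k), t) i = Function.update (fun _ => S₀) k (S₀ + E t) := by
      funext k'
      by_cases hk : k' = k
      · subst hk; simpa using hS' ((i, k'), t)
      · rw [Function.update_of_ne hk]
        exact hne _ _ _ (by simpa using hk)
    have key := weight_mul_l2norm_sgnn_sub_le (S := fun _ _ => S₀) (S' := S' ((i, k), t))
      (d := |C_g| * r) hc hσ hσ0 (abs_nonneg C_U)
      (fun i y => l2norm_graphFilter_const_le (abs_nonneg C_U)
        (fun lam hlam => (hU i lam hlam).trans (le_abs_self _)) hS₀ hΛ y)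
      (by positivity) x i
      (fun i' hi' => by funext k'; exact hne _ _ _ (by simp [hi']))
      (fun y => by
        rw [hupd]
        exact l2norm_graphFilter_update_sub_le (hg i k) hS₀ hΛ (E t) hr (hE t) y)
    have hw := i.weight_pos
    rw [← hβ] at key
    -- The bound on weight times effect, divided by the weight and squared.
    rw [inv_mul_eq_div, le_div_iff₀ (by positivity), mul_comm, ← mul_pow]
    exact pow_le_pow_left₀ (mul_nonneg hw.le (l2norm_nonneg _)) key 2
  calc _ ≤ ∑ j : (FilterIdx L F × Fin K) × T, (j.1.1.weight ^ 2)⁻¹ * β ^ 2 :=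
        Finset.sum_le_sum fun j _ => hterm j
    _ = K * Fintype.card T * (∑ i : FilterIdx L F, (i.weight ^ 2)⁻¹) * β ^ 2 := by
        simp only [Fintype.sum_prod_type, ← Finset.sum_mul, Finset.sum_const, Finset.card_univ,
          Fintype.card_fin, nsmul_eq_mul, ← Finset.mul_sum]
        ring
    _ ≤ _ := by
        have := FilterIdx.sum_inv_weight_sq_le (F := F) hL
        gcongr

end Perturbation

/-! ### Comparison with the stated constants -/

section Constants

/-- The squared effect carries `c ^ (2L)`, which is at most `C_σ ^ (2l - 2)` for each `l ≤ L`
because `c ≤ 1` and `c ≤ |C_σ|`. Hence the `L` equal contributions are dominated term by term. Even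
exponents make the signs of `C_σ` and `C_U` irrelevant. -/
lemma card_mul_propagation_sq_le {L F K M : ℕ} (hL : 2 ≤ L) {c r α C_U C_g C_σ X : ℝ}
    (hc : 0 ≤ c) (hc1 : c ≤ 1) (hcσ : c ≤ |C_σ|) (hr : r ^ 2 = 2 * α) (hα : 0 ≤ α) :
    K * M * (L * F) * (c * (|C_g| * r) * (c * |C_U|) * (c * F * |C_U|) ^ (L - 2) * X) ^ 2
      ≤ 2 * α * M * (∑ l ∈ Finset.Icc 1 L, (F : ℝ) ^ (2 * L - 3) * C_σ ^ (2 * l - 2)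
          * C_U ^ (2 * L - 2) * K * C_g ^ 2) * X ^ 2 := by
  obtain ⟨n, rfl⟩ := Nat.exists_eq_add_of_le hL
  have e1 : 2 + n - 2 = n := by omega
  have e2 : 2 * (2 + n) - 3 = 2 * n + 1 := by omega
  have e3 : 2 * (2 + n) - 2 = 2 * n + 2 := by omega
  rw [e1, e2, e3]
  have hpow : ∀ l ∈ Finset.Icc 1 (2 + n), c ^ (2 * n + 4) ≤ C_σ ^ (2 * l - 2) := by
    intro l hl
    have hl' := Finset.mem_Icc.1 hl
    have he : Even (2 * l - 2) := ⟨l - 1, by omega⟩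
    rw [← he.pow_abs]
    exact (pow_le_pow_of_le_one hc hc1 (by omega)).trans (pow_le_pow_left₀ hc hcσ _)
  have hU : |C_U| ^ (2 * n + 2) = C_U ^ (2 * n + 2) := Even.pow_abs ⟨n + 1, by ring⟩ _
  have hsum : ((2 + n : ℕ) : ℝ) * ((F : ℝ) ^ (2 * n + 1) * c ^ (2 * n + 4)
        * C_U ^ (2 * n + 2) * K * C_g ^ 2)
      ≤ ∑ l ∈ Finset.Icc 1 (2 + n), (F : ℝ) ^ (2 * n + 1) * C_σ ^ (2 * l - 2)
          * C_U ^ (2 * n + 2) * K * C_g ^ 2 := by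
    have hcard : ((2 + n : ℕ) : ℝ) * ((F : ℝ) ^ (2 * n + 1) * c ^ (2 * n + 4)
        * C_U ^ (2 * n + 2) * K * C_g ^ 2)
        = ∑ _l ∈ Finset.Icc 1 (2 + n), (F : ℝ) ^ (2 * n + 1) * c ^ (2 * n + 4)
          * C_U ^ (2 * n + 2) * K * C_g ^ 2 := by simp
    rw [hcard]
    refine Finset.sum_le_sum fun l hl => ?_
    have := hpow l hl
    rw [← hU]
    gcongr
  calc _ = 2 * α * M * (((2 + n : ℕ) : ℝ) * ((F : ℝ) ^ (2 * n + 1) * c ^ (2 * n + 4)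
        * C_U ^ (2 * n + 2) * K * C_g ^ 2)) * X ^ 2 := by
        rw [← hU, ← hr, ← sq_abs C_g]
        ring
    _ ≤ _ := by gcongr

end Constants

/-- Each output is bounded separately and the triangle inequality doubles the bound, whence the 4.
This feeds `R`, so it uses only coefficient and shift bounds. -/
lemma l2norm_sgnn_sub_sq_le {V : Type*} [Fintype V] {L F K : ℕ} {σ : ℝ → ℝ} (hσ0 : σ 0 = 0)
    (hσ : ∀ a b, |σ a - σ b| ≤ |a - b|) {h : FilterIdx L F → Fin (K + 1) → ℝ} {a b : ℝ}
    (ha0 : 0 ≤ a) (ha : ∀ i k, |h i k| ≤ a) (hb1 : 1 ≤ b)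
    {S S' : FilterIdx L F → Fin K → Matrix V V ℝ}
    (hS : ∀ i k, frobSq (S i k) ≤ b ^ 2) (hS' : ∀ i k, frobSq (S' i k) ≤ b ^ 2) (x : V → ℝ) :
    l2norm (sgnn σ h S' x - sgnn σ h S x) ^ 2
      ≤ 4 * (F * ((K + 1) * a * b ^ K) * ((K + 1) * a * b ^ K
        * (F * ((K + 1) * a * b ^ K)) ^ (L - 2))) ^ 2 * l2norm x ^ 2 := by
  have hσ' : ∀ s t, |σ s - σ t| ≤ 1 * |s - t| := by simpa using hσ
  have hb0 : 0 ≤ b := zero_le_one.trans hb1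
  have key : ∀ T : FilterIdx L F → Fin K → Matrix V V ℝ, (∀ i k, frobSq (T i k) ≤ b ^ 2) →
      l2norm (sgnn σ h T x) ≤ (F * ((K + 1) * a * b ^ K) * ((K + 1) * a * b ^ K
        * (F * ((K + 1) * a * b ^ K)) ^ (L - 2))) * l2norm x := fun T hT => by
    simpa using l2norm_sgnn_le zero_le_one hσ' hσ0 (by positivity)
      (fun i y => l2norm_graphFilter_le (ha i) (hT i) hb1 y) x
  have h1 := (l2norm_sub_le _ _).trans (add_le_add (key S' hS') (key S hS))
  calc _ ≤ _ := pow_le_pow_left₀ (l2norm_nonneg _) h1 2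
    _ = _ := by ring

/-- The events of a family of independent realizations, or their complements, have product
probabilities for distinct edges. -/
lemma IsRESFamily.measureReal_inter {V Ω ι : Type*} [MeasurableSpace Ω] {G : SimpleGraph V}
    {p : ℝ} {μ : Measure Ω} {𝒢 : ι → Ω → SimpleGraph V} (hG : IsRESFamily G p μ 𝒢)
    {i j : ι × G.edgeSet} (hij : i ≠ j) :
    let E := fun q : ι × G.edgeSet => {ω | (q.2 : Sym2 V) ∈ (𝒢 q.1 ω).edgeSet}
    μ.real (E i ∩ E j) = μ.real (E i) * μ.real (E j) ∧
      μ.real ((E i)ᶜ ∩ (E j)ᶜ) = μ.real (E i)ᶜ * μ.real (E j)ᶜ := by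
  classical
  intro E
  -- Independence of events is independence of the σ-algebras they generate, so it covers
  -- complements too.
  have key : ∀ f : ι × G.edgeSet → Set Ω,
      (∀ q ∈ ({i, j} : Finset (ι × G.edgeSet)),
        MeasurableSet[MeasurableSpace.generateFrom {E q}] (f q)) →
      μ (⋂ q ∈ ({i, j} : Finset (ι × G.edgeSet)), f q)
        = ∏ q ∈ ({i, j} : Finset (ι × G.edgeSet)), μ (f q) :=
    fun f hf => (iIndepSet_iff _ _).1 hG.indep {i, j} hf
  constructor
  · have := key E fun q _ => MeasurableSpace.measurableSet_generateFrom rfl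
    rw [Finset.prod_pair hij] at this
    simp only [Finset.mem_insert, Finset.mem_singleton, Set.iInter_iInter_eq_or_left,
      Set.iInter_iInter_eq_left] at this
    rw [measureReal_def, this, ENNReal.toReal_mul]
    rfl
  · have := key (fun q => (E q)ᶜ) fun q _ =>
      MeasurableSet.compl (m := MeasurableSpace.generateFrom {E q})
        (MeasurableSpace.measurableSet_generateFrom rfl)
    rw [Finset.prod_pair hij] at this
    simp only [Finset.mem_insert, Finset.mem_singleton, Set.iInter_iInter_eq_or_left,
      Set.iInter_iInter_eq_left] at this
    rw [measureReal_def, this, ENNReal.toReal_mul]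
    rfl

end SGNN

/-! ### The variance bound -/

open SGNN

theorem theorem1 {V : Type*} [Fintype V] [DecidableEq V] (G : SimpleGraph V) (s : SGNN.ShiftKind)
    (L F K : ℕ) (hL : 2 ≤ L) (C_U C_g C_σ : ℝ) :
    ∃ R : ℝ,
      ∀ (Λ : Set ℝ), (∀ H : SimpleGraph V, H ≤ G → spectrum ℝ (SGNN.shiftOp s H) ⊆ Λ) →
      ∀ (h : SGNN.FilterIdx L F → Fin (K + 1) → ℝ),
        (∀ i, ∀ lam ∈ Λ, |SGNN.freqResponse (h i) lam| ≤ C_U) →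
        (∀ i, ∀ lam₁ lam₂ : EuclideanSpace ℝ (Fin K),
          (∀ j, lam₁ j ∈ Λ) → (∀ j, lam₂ j ∈ Λ) →
          |SGNN.genFreqResponse (h i) lam₁ - SGNN.genFreqResponse (h i) lam₂|
            ≤ C_g * ‖lam₁ - lam₂‖) →
      ∀ (σ : ℝ → ℝ), σ 0 = 0 → (∀ a b : ℝ, |σ a - σ b| ≤ C_σ * |a - b|) →
        SGNN.VarianceNonincreasing σ →
      ∀ (x : EuclideanSpace ℝ V) (p : ℝ), 0 ≤ p → p ≤ 1 →
      ∀ {Ω : Type*} [MeasurableSpace Ω] (μ : Measure Ω) [IsProbabilityMeasure μ]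
        (𝒢 : SGNN.FilterIdx L F × Fin K → Ω → SimpleGraph V), SGNN.IsRESFamily G p μ 𝒢 →
        (∀ v, MemLp (fun ω => SGNN.randomOutput s σ h (fun q => 𝒢 q ω) x v) 2 μ) ∧
        ∑ v, variance (fun ω => SGNN.randomOutput s σ h (fun q => 𝒢 q ω) x v) μ
          ≤ p * (1 - p)
              * (2 * s.alpha * (G.edgeSet.ncard : ℝ)
                  * ∑ l ∈ Finset.Icc 1 L,
                      (F : ℝ) ^ (2 * L - 3) * C_σ ^ (2 * l - 2) * C_U ^ (2 * L - 2)
                        * (K : ℝ) * C_g ^ 2)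
              * ‖x‖ ^ 2
            + R * ‖x‖ ^ 2 * (p ^ 2 * (1 - p) ^ 2) := by
  classical
  obtain ⟨b, hb1, hb⟩ := exists_frobSq_shiftOp_le V s
  let a : ℝ := |C_U| + |C_g|
  let P : ℝ := F * ((K + 1) * a * b ^ K) * ((K + 1) * a * b ^ K
    * (F * ((K + 1) * a * b ^ K)) ^ (L - 2))
  let J : Type _ := (FilterIdx L F × Fin K) × G.edgeSet
  let C : ℝ := 2 * s.alpha * (G.edgeSet.ncard : ℝ)
    * ∑ l ∈ Finset.Icc 1 L, (F : ℝ) ^ (2 * L - 3) * C_σ ^ (2 * l - 2) * C_U ^ (2 * L - 2)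
      * (K : ℝ) * C_g ^ 2
  -- `C` enters `R` through `q = q(1-q) + q²`, the other term bounds the pairs in `J`, `P` bounds
  -- the gain of the network, and the outer 4 comes from `1 ≤ 4(1-q)²`.
  refine ⟨4 * (C + (Fintype.card J : ℝ) ^ 2 * (4 * P ^ 2)), ?_⟩
  intro Λ hΛ h hU hg σ hσ0 hσ hv x p hp0 hp1 Ω _ μ _ 𝒢 hG
  have hα := s.alpha_pos
  have hσ1 : ∀ t₁ t₂, |σ t₁ - σ t₂| ≤ |t₁ - t₂| := hv.abs_sub_le
    (LipschitzWith.of_dist_le' (K := C_σ) fun t₁ t₂ => hσ t₁ t₂).continuous.measurable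
  let c : ℝ := min 1 |C_σ|
  have hc0 : 0 ≤ c := le_min zero_le_one (abs_nonneg _)
  have hσc : ∀ t₁ t₂, |σ t₁ - σ t₂| ≤ c * |t₁ - t₂| := by
    intro t₁ t₂
    rcases min_choice 1 |C_σ| with hm | hm
    · simpa [c, hm] using hσ1 t₁ t₂
    · simp only [c, hm]
      exact (hσ t₁ t₂).trans (mul_le_mul_of_nonneg_right (le_abs_self _) (abs_nonneg _))
  have hC0 : 0 ≤ C := by
    refine mul_nonneg (by positivity) (Finset.sum_nonneg fun l hl => ?_)
    have h1 : 0 ≤ C_σ ^ (2 * l - 2) :=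
      Even.pow_nonneg ⟨l - 1, by have := Finset.mem_Icc.1 hl; omega⟩ _
    have h2 : 0 ≤ C_U ^ (2 * L - 2) := Even.pow_nonneg ⟨L - 1, by omega⟩ _
    positivity
  -- An element of `J` supplies an edge of `G`; without one, `Λ` need not contain two distinct
  -- points.
  have hpart : ∀ _j : J, ((0 : ℝ) ∈ Λ ∧ ∃ t ∈ Λ, 1 ≤ |t|) ∧
      ∀ i k₀, ∀ t₁ ∈ Λ, ∀ t₂ ∈ Λ, |partialResponse (h i) k₀ t₁ t₂| ≤ C_g := by
    intro j
    have hΛ' := exists_mem_spectrum_of_edge s j.2 hΛ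
    refine ⟨hΛ', fun i k₀ t₁ ht₁ t₂ ht₂ => ?_⟩
    obtain ⟨h0, t, ht, ht1⟩ := hΛ'
    have hne : (0 : ℝ) ≠ t := by
      rintro rfl
      norm_num at ht1
    exact abs_partialResponse_le (hg i) h0 ht hne k₀ ht₁ ht₂
  let Φ : Set J → V → ℝ := fun A =>
    sgnn σ h (fun i k => shiftOp s (activeGraph G A (i, k))) x
  have hdiff : ∀ _j : J, ∀ A A' : Set J, l2norm (Φ A' - Φ A) ^ 2 ≤ 4 * P ^ 2 * ‖x‖ ^ 2 := by
    intro j A A'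
    obtain ⟨⟨h0, t, ht, ht1⟩, hpart⟩ := hpart j
    exact l2norm_sgnn_sub_sq_le hσ0 hσ1 (add_nonneg (abs_nonneg _) (abs_nonneg _))
      (fun i k => abs_coeff_le (hU i) (hpart i) h0 ht ht1 k) hb1 (fun _ _ => hb _)
      (fun _ _ => hb _) x
  -- The sign `ε` treats adding an edge to the empty graph and deleting one from `G` together.
  have hsum : ∀ (A₀ : Set J) (A' : J → Set J) (H : SimpleGraph V) (ε : ℝ), H ≤ G → ε ^ 2 = 1 →
      (∀ i, activeGraph G A₀ i = H) →
      (∀ j, shiftOp s (activeGraph G (A' j) j.1) = shiftOp s H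
        + ε • shiftOp s (SimpleGraph.fromEdgeSet {(j.2 : Sym2 V)})) →
      (∀ j i, i ≠ j.1 → activeGraph G (A' j) i = H) →
      ∑ j, l2norm (Φ (A' j) - Φ A₀) ^ 2 ≤ C * ‖x‖ ^ 2 := by
    intro A₀ A' H ε hH hε h₀ h₁ h₂
    rcases isEmpty_or_nonempty J with hJ | ⟨⟨j⟩⟩
    · rw [Finset.univ_eq_empty, Finset.sum_empty]
      exact mul_nonneg hC0 (sq_nonneg _)
    · have hΦ₀ : Φ A₀ = sgnn σ h (fun _ _ => shiftOp s H) x := by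
        simp only [Φ, h₀]
      have hr : √(2 * s.alpha) ^ 2 = 2 * s.alpha := Real.sq_sqrt (by positivity)
      have key := sum_sq_l2norm_sgnn_sub_le (T := G.edgeSet) hL hc0 hσc hσ0 hU (hpart j).2
        (shiftOp_isHermitian s H) (hΛ H hH)
        (fun e => ε • shiftOp s (SimpleGraph.fromEdgeSet {(e : Sym2 V)}))
        (Real.sqrt_nonneg (2 * s.alpha))
        (fun e => by
          rw [hr, ← frobSq_shiftOp_edgeSet s e]
          simp [frobSq, mul_pow, hε])
        (fun j i k => shiftOp s (activeGraph G (A' j) (i, k)))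
        h₁ (fun j i k hne => by rw [h₂ j (i, k) hne]) x
      rw [hΦ₀]
      refine key.trans ?_
      have := card_mul_propagation_sq_le (F := F) (K := K) (M := Fintype.card G.edgeSet)
        (C_U := C_U) (C_g := C_g) (X := l2norm x) hL hc0 (min_le_left _ _) (min_le_right _ _) hr hα.le
      refine this.trans_eq ?_
      simp only [C, Set.ncard_eq_toFinset_card', Set.toFinset_card]
      rfl
  let A : Ω → Set J := fun ω => {j | (j.2 : Sym2 V) ∈ (𝒢 j.1 ω).edgeSet}
  have hA : ∀ j : J, MeasurableSet {ω | j ∈ A ω} := fun j =>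
    hG.measurableSet_edge j.1 j.2 j.2.2
  have hprob : ∀ j : J, μ.real {ω | j ∈ A ω} = p := fun j => by
    have := hG.prob_edge j.1 j.2 j.2.2
    rw [measureReal_def]
    exact (congrArg ENNReal.toReal this).trans (ENNReal.toReal_ofReal hp0)
  have hout : ∀ v, (fun ω => randomOutput s σ h (fun q => 𝒢 q ω) x v) = fun ω => Φ (A ω) v := by
    intro v
    funext ω
    have e : activeGraph G (A ω) = fun q => 𝒢 q ω :=
      activeGraph_setOf_mem fun q => hG.le q ω
    simp only [Φ]
    rw [e]
    rfl
  simp only [hout]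
  refine ⟨fun v => memLp_comp_randomSet hA fun a => Φ a v, ?_⟩
  -- The base point is the more likely extreme: no active edges if `p ≤ 1/2`, all of them otherwise.
  rcases le_total p (1 / 2) with hp | hp
  · refine (sum_variance_le_of_le_half hA hp0 hp hprob (fun i j hij => ?_) Φ
      (B := 4 * P ^ 2) (X := ‖x‖ ^ 2) (by positivity) hC0 (sq_nonneg _)
      (fun _ ⟨j, _⟩ => hdiff j _ _) (hsum ∅ (fun j => {j}) ⊥ 1 bot_le (by norm_num)
        activeGraph_empty (fun j => ?_) (fun j i hij => ?_))).trans_eq ?_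
    · rw [sq]
      nth_rw 1 [← hprob i]
      rw [← hprob j]
      exact (hG.measureReal_inter hij).1
    · rw [shiftOp_activeGraph_singleton, activeGraph_empty, one_smul]
    · rw [activeGraph_singleton_of_ne hij, activeGraph_empty]
    · ring
  · have hprob' : ∀ j : J, μ.real {ω | j ∈ (A ω)ᶜ} = 1 - p := fun j => by
      have := probReal_compl_eq_one_sub (μ := μ) (hA j)
      rw [hprob] at this
      exact this
    have key := sum_variance_le_of_le_half (A := fun ω => (A ω)ᶜ) (fun j => (hA j).compl)
      (sub_nonneg.2 hp1) (by linarith) hprob' (fun i j hij => by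
        rw [sq]
        nth_rw 1 [← hprob' i]
        rw [← hprob' j]
        exact (hG.measureReal_inter hij).2) (fun a => Φ aᶜ)
      (B := 4 * P ^ 2) (X := ‖x‖ ^ 2) (by positivity) hC0 (sq_nonneg _)
      (fun _ ⟨j, _⟩ => hdiff j _ _) (hsum ∅ᶜ (fun j => {j}ᶜ) G (-1) le_rfl (by norm_num)
        (fun i => by rw [Set.compl_empty, activeGraph_univ])
        (fun j => by rw [shiftOp_activeGraph_compl_singleton, activeGraph_univ, neg_one_smul])
        (fun j i hij => by rw [activeGraph_compl_singleton_of_ne hij, activeGraph_univ]))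
    simp only [compl_compl] at key
    refine key.trans_eq ?_
    ring
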